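/- All algebras are associative algebras over $\mathbb{C}$, not necessarily unital. The product of an algebra $B$ is *non-degenerate* if $b=0$ whenever $bc=0$ for all $c\in B$ or $cb=0$ for all $c\in B$; $M(B)$ denotes the multiplier algebra. Let $(A,\Delta)$ be a regular weak multiplier Hopf algebra. That is, first, $(A,\Delta)$ is a weak multiplier Hopf algebra: $A$ is an idempotent algebra with non-degenerate product, and $\Delta:A\to M(A\otimes A)$ is a full coproduct (a homomorphism with $\Delta(a)(1\otimes b)\in A\otimes A$ and $(a\otimes 1)\Delta(b)\in A\otimes A$ for all $a,b\in A$, which is coassociative) that admits a counit, such that: 1. there is an idempotent $E\in M(A\otimes A)$ with $E(A\otimes A)=T_1(A\otimes A)$ and $(A\otimes A)E=T_2(A\otimes A)$, where $T_1(a\otimes b)=\Delta(a)(1\otimes b)$ and $T_2(a\otimes b)=(a\otimes 1)\Delta(b)$; 2. $(\iota\otimes\Delta)E=(E\otimes 1)(1\otimes E)=(1\otimes E)(E\otimes 1)$, where $\iota\otimes\Delta$ is extended to $M(A\otimes A)$ with value $1\otimes E$ at $1$; 3. $\ker T_i=(1-G_i)(A\otimes A)$ for $i=1,2$, where $G_1,G_2$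 are the linear maps on $A\otimes A$ given by $(G_1\otimes\iota)(\Delta_{13}(a)(1\otimes b\otimes c))=\Delta_{13}(a)(1\otimes E)(1\otimes b\otimes c)$ and $(\iota\otimes G_2)((a\otimes b\otimes 1)\Delta_{13}(c))=(a\otimes b\otimes 1)(E\otimes 1)\Delta_{13}(c)$. Second, regularity means that also $\Delta(a)(b\otimes 1)$ and $(1\otimes a)\Delta(b)$ lie in $A\otimes A$ for all $a,b\in A$, and $(A,\Delta^{\mathrm{cop}})$ is a weak multiplier Hopf algebra. Let $E\in M(A\otimes A)$ be the canonical idempotent, i.e. the (unique) idempotent as in 1. Let $R$ be a left $A$-module algebra: an algebra with non-degenerate product which is a left $A$-module with $A\rhd R=R$, such that $a\rhd(xy)=\sum(a_{(1)}\rhd x)(a_{(2)}\rhd y)$ for all $a\in A$, $x,y\in R$, i.e. $a\rhd(xy)=m(\Delta(a)\rhd(x\otimes y))$, where $m$ is the product of $R$ and $M(A\otimes A)$ acts on $R\otimes R$ by the extension of the action $(a\otimes b)\rhd(x\otimes y)=(a\rhd x)\otimes(b\rhd y)$ of $A\otimes A$. Denote by $R\#A$ the space $R\otimes A$ with the product $$(r\otimes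 a)(s\otimes b)=\sum r(a_{(1)}\rhd s)\otimes a_{(2)}b ,\qquad \sum a_{(1)}\otimes a_{(2)}b:=\Delta(a)(1\otimes b)\in A\otimes A .$$ Then: * (i) the product of $R\#A$ is associative; * (ii) the action $(p\otimes q)\rhd(r\otimes a)=(p\rhd r)\otimes qa$ of $A\otimes A$ on $R\# A$ extends to $M(A\otimes A)$ by $m\rhd(t\rhd x)=(mt)\rhd x$ for $m\in M(A\otimes A)$, $t\in A\otimes A$, $x\in R\#A$, and for all $x,y\in R\#A$ $$(E\rhd x)y=xy=x(E\rhd y),\qquad E\rhd(xy)=(E\rhd x)y ;$$ * (iii) the subspace $R\#_EA:=E\rhd(R\#A)$ is a subalgebra and a right ideal of $R\#A$; * (iv) the product of the algebra $R\#_EA$ is non-degenerate. -/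

import Mathlib

open scoped TensorProduct

noncomputable section

namespace WMHA

section Multipliers

variable (A : Type*) [NonUnitalRing A] [Module ℂ A] [IsScalarTower ℂ A A] [SMulCommClass ℂ A A]

/-- The product of `A` is non-degenerate. -/
def IsNondegenerateAlgebra : Prop :=
  (∀ a : A, (∀ b : A, a * b = 0) → a = 0) ∧ (∀ a : A, (∀ b : A, b * a = 0) → a = 0)

/-- `A² = A`. -/
def IsIdempotentAlgebra : Prop :=
  Submodule.span ℂ {x : A | ∃ a b : A, x = a * b} = ⊤

/-- The multiplier algebra `M(A)`: pairs `(l, r)` of linear maps with `l(ab) = l(a)b`,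
`r(ab) = a r(b)` and `r(a)b = a l(b)`. Left multipliers are multiplied by composition, right
multipliers by composition in the opposite order. -/
def multiplierAlgebra : Subalgebra ℂ (Module.End ℂ A × (Module.End ℂ A)ᵐᵒᵖ) where
  carrier := {m | (∀ a b, m.1 (a * b) = m.1 a * b) ∧
    (∀ a b, m.2.unop (a * b) = a * m.2.unop b) ∧ (∀ a b, m.2.unop a * b = a * m.1 b)}
  mul_mem' := by
    rintro m n ⟨h1, h2, h3⟩ ⟨k1, k2, k3⟩
    exact ⟨fun a b => by simp [h1, k1], fun a b => by simp [h2, k2], fun a b => by simp [h3, k3]⟩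
  add_mem' := by
    rintro m n ⟨h1, h2, h3⟩ ⟨k1, k2, k3⟩
    exact ⟨fun a b => by simp [h1, k1, add_mul], fun a b => by simp [h2, k2, mul_add],
      fun a b => by simp [h3, k3, add_mul, mul_add]⟩
  algebraMap_mem' := by
    intro c
    refine ⟨fun a b => ?_, fun a b => ?_, fun a b => ?_⟩ <;>
      simp [Module.algebraMap_end_apply, smul_mul_assoc, mul_smul_comm]

/-- `M(A)`. -/
abbrev Multiplier : Type _ := ↥(multiplierAlgebra A)

variable {A}

/-- `m · a`. -/
def Multiplier.left (m : Multiplier A) : A →ₗ[ℂ] A := m.1.1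

/-- `a · m`, as a function of `a`. -/
def Multiplier.right (m : Multiplier A) : A →ₗ[ℂ] A := m.1.2.unop

/-- The canonical map `A → M(A)`. -/
def embed : A →ₗ[ℂ] Multiplier A where
  toFun a := ⟨(LinearMap.mulLeft ℂ a, MulOpposite.op (LinearMap.mulRight ℂ a)),
    fun b c => by simp [mul_assoc], fun b c => by simp [mul_assoc],
    fun b c => by simp [mul_assoc]⟩
  map_add' a b := by
    apply Subtype.ext; apply Prod.ext
    · ext x; simp [add_mul]
    · apply MulOpposite.unop_injective; ext x; simp [mul_add]
  map_smul' c a := by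
    apply Subtype.ext; apply Prod.ext
    · ext x; simp [smul_mul_assoc]
    · apply MulOpposite.unop_injective; ext x; simp [mul_smul_comm]

open Classical in
/-- A linear left inverse of `A → M(A)` (for non-degenerate `A`). It is only meant to be applied
to multipliers that lie in the image of `A`, where it gives the element they come from. -/
def unembed : Multiplier A →ₗ[ℂ] A :=
  if h : LinearMap.ker (embed : A →ₗ[ℂ] Multiplier A) = ⊥ then
    (LinearMap.exists_leftInverse_of_injective _ h).choose
  else 0

theorem embed_unembed (hA : IsNondegenerateAlgebra A) {m : Multiplier A}
    (hm : m ∈ LinearMap.range (embed : A →ₗ[ℂ] Multiplier A)) : embed (unembed m) = m := by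
  have h : LinearMap.ker (embed : A →ₗ[ℂ] Multiplier A) = ⊥ := by
    rw [LinearMap.ker_eq_bot']
    intro a ha
    refine hA.1 a fun b => ?_
    have := congrArg (fun m : Multiplier A => m.left b) ha
    simpa [Multiplier.left, embed] using this
  obtain ⟨a, rfl⟩ := hm
  rw [unembed, dif_pos h]
  have := LinearMap.congr_fun (LinearMap.exists_leftInverse_of_injective _ h).choose_spec a
  rw [LinearMap.comp_apply, LinearMap.id_apply] at this
  rw [this]

variable {B : Type*} [NonUnitalRing B] [Module ℂ B] [IsScalarTower ℂ B B] [SMulCommClass ℂ B B]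

/-- `M(A) ⊗ M(B) ⊆ M(A ⊗ B)`: the multiplier `m ⊗ n`. -/
def tens : Multiplier A →ₗ[ℂ] Multiplier B →ₗ[ℂ] Multiplier (A ⊗[ℂ] B) :=
  LinearMap.mk₂ ℂ
    (fun m n => ⟨(TensorProduct.map m.left n.left,
        MulOpposite.op (TensorProduct.map m.right n.right)), by
      obtain ⟨m, h1, h2, h3⟩ := m
      obtain ⟨n, k1, k2, k3⟩ := n
      refine ⟨fun a b => ?_, fun a b => ?_, fun a b => ?_⟩ <;>
      · induction a using TensorProduct.induction_on with
        | zero => simp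
        | add x y hx hy => simp only [add_mul, map_add, hx, hy]
        | tmul x y =>
          induction b using TensorProduct.induction_on with
          | zero => simp
          | add x y hx hy => simp only [mul_add, map_add, hx, hy]
          | tmul z w =>
            simp [Multiplier.left, Multiplier.right, h1, h2, h3, k1, k2, k3]⟩)
    (fun m m' n => by
      apply Subtype.ext; apply Prod.ext
      · exact TensorProduct.map_add_left _ _ _
      · exact MulOpposite.unop_injective (TensorProduct.map_add_left _ _ _))
    (fun c m n => by
      apply Subtype.ext; apply Prod.ext
      · exact TensorProduct.map_smul_left _ _ _
      · exact MulOpposite.unop_injective (TensorProduct.map_smul_left _ _ _))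
    (fun m n n' => by
      apply Subtype.ext; apply Prod.ext
      · exact TensorProduct.map_add_right _ _ _
      · exact MulOpposite.unop_injective (TensorProduct.map_add_right _ _ _))
    (fun c m n => by
      apply Subtype.ext; apply Prod.ext
      · exact TensorProduct.map_smul_right _ _ _
      · exact MulOpposite.unop_injective (TensorProduct.map_smul_right _ _ _))

/-- The isomorphism `M(A) → M(B)` induced by an isomorphism of algebras `e : A → B`. -/
def transport (e : A ≃ₗ[ℂ] B) (he : ∀ x y, e (x * y) = e x * e y) :
    Multiplier A →ₐ[ℂ] Multiplier B where
  toFun m := ⟨(e.toLinearMap ∘ₗ m.left ∘ₗ e.symm.toLinearMap,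
      MulOpposite.op (e.toLinearMap ∘ₗ m.right ∘ₗ e.symm.toLinearMap)), by
    have he' : ∀ x y, e.symm (x * y) = e.symm x * e.symm y := fun x y => by
      apply e.injective; simp [he]
    obtain ⟨m, h1, h2, h3⟩ := m
    refine ⟨fun a b => ?_, fun a b => ?_, fun a b => ?_⟩
    · simp [Multiplier.left, he', h1, he]
    · simp [Multiplier.right, he', h2, he]
    · have := congrArg e (h3 (e.symm a) (e.symm b))
      simpa [Multiplier.left, Multiplier.right, he] using this⟩
  map_one' := by
    apply Subtype.ext; apply Prod.ext
    · ext x; simp [Multiplier.left]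
    · apply MulOpposite.unop_injective; ext x; simp [Multiplier.right]
  map_mul' m n := by
    apply Subtype.ext; apply Prod.ext
    · ext x; simp [Multiplier.left]
    · apply MulOpposite.unop_injective; ext x; simp [Multiplier.right]
  map_zero' := by
    apply Subtype.ext; apply Prod.ext
    · ext x; simp [Multiplier.left]
    · apply MulOpposite.unop_injective; ext x; simp [Multiplier.right]
  map_add' m n := by
    apply Subtype.ext; apply Prod.ext
    · ext x; simp [Multiplier.left]
    · apply MulOpposite.unop_injective; ext x; simp [Multiplier.right]
  commutes' c := by
    apply Subtype.ext; apply Prod.ext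
    · ext x; simp [Multiplier.left, Module.algebraMap_end_apply]
    · apply MulOpposite.unop_injective; ext x
      simp [Multiplier.right, Module.algebraMap_end_apply]

end Multipliers

section Coproducts

variable {A : Type*} [NonUnitalRing A] [Module ℂ A] [IsScalarTower ℂ A A] [SMulCommClass ℂ A A]

theorem assoc_mul (x y : (A ⊗[ℂ] A) ⊗[ℂ] A) :
    TensorProduct.assoc ℂ A A A (x * y) =
      TensorProduct.assoc ℂ A A A x * TensorProduct.assoc ℂ A A A y := by
  have h : (LinearMap.mul ℂ _).compr₂ (TensorProduct.assoc ℂ A A A).toLinearMap =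
      (LinearMap.mul ℂ _).compl₁₂ (TensorProduct.assoc ℂ A A A).toLinearMap
        (TensorProduct.assoc ℂ A A A).toLinearMap := by
    ext; simp
  exact LinearMap.congr_fun₂ h x y

theorem comm_mul (x y : A ⊗[ℂ] A) :
    TensorProduct.comm ℂ A A (x * y) =
      TensorProduct.comm ℂ A A x * TensorProduct.comm ℂ A A y := by
  have h : (LinearMap.mul ℂ _).compr₂ (TensorProduct.comm ℂ A A).toLinearMap =
      (LinearMap.mul ℂ _).compl₁₂ (TensorProduct.comm ℂ A A).toLinearMap
        (TensorProduct.comm ℂ A A).toLinearMap := by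
    ext; simp
  exact LinearMap.congr_fun₂ h x y

/-- The isomorphism `(A ⊗ A) ⊗ A → A ⊗ (A ⊗ A)`, `(p ⊗ q) ⊗ b ↦ p ⊗ (b ⊗ q)`. -/
def leg13 : (A ⊗[ℂ] A) ⊗[ℂ] A ≃ₗ[ℂ] A ⊗[ℂ] (A ⊗[ℂ] A) :=
  (TensorProduct.assoc ℂ A A A).trans
    (TensorProduct.congr (LinearEquiv.refl ℂ A) (TensorProduct.comm ℂ A A))

theorem leg13_mul (x y : (A ⊗[ℂ] A) ⊗[ℂ] A) : leg13 (x * y) = leg13 x * leg13 y := by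
  have h : (LinearMap.mul ℂ _).compr₂ (leg13 (A := A)).toLinearMap =
      (LinearMap.mul ℂ _).compl₁₂ (leg13 (A := A)).toLinearMap
        (leg13 (A := A)).toLinearMap := by
    ext; simp [leg13]
  exact LinearMap.congr_fun₂ h x y

variable (Δ : A →ₙₐ[ℂ] Multiplier (A ⊗[ℂ] A))

/-- The canonical map `T₁(a ⊗ b) = Δ(a)(1 ⊗ b)`. -/
def T₁ : A ⊗[ℂ] A →ₗ[ℂ] A ⊗[ℂ] A :=
  TensorProduct.lift ((LinearMap.mul ℂ (Multiplier (A ⊗[ℂ] A))).compl₁₂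
    (Δ : A →ₗ[ℂ] Multiplier (A ⊗[ℂ] A)) (tens (1 : Multiplier A) ∘ₗ embed) |>.compr₂ unembed)

/-- The canonical map `T₂(a ⊗ b) = (a ⊗ 1)Δ(b)`. -/
def T₂ : A ⊗[ℂ] A →ₗ[ℂ] A ⊗[ℂ] A :=
  TensorProduct.lift ((LinearMap.mul ℂ (Multiplier (A ⊗[ℂ] A))).compl₁₂
    ((tens : Multiplier A →ₗ[ℂ] Multiplier A →ₗ[ℂ] _).flip 1 ∘ₗ embed)
    (Δ : A →ₗ[ℂ] Multiplier (A ⊗[ℂ] A)) |>.compr₂ unembed)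

theorem T₁_tmul (a b : A) : T₁ Δ (a ⊗ₜ b) = unembed (Δ a * tens 1 (embed b)) := rfl

theorem T₂_tmul (a b : A) : T₂ Δ (a ⊗ₜ b) = unembed (tens (embed a) 1 * Δ b) := rfl

/-- `Δ ⊗ ι : A ⊗ A → M(A ⊗ A ⊗ A)`. -/
def coprodTensorId : A ⊗[ℂ] A →ₗ[ℂ] Multiplier (A ⊗[ℂ] (A ⊗[ℂ] A)) :=
  (transport (TensorProduct.assoc ℂ A A A) assoc_mul).toLinearMap ∘ₗ
    TensorProduct.lift (tens.compl₁₂ (Δ : A →ₗ[ℂ] Multiplier (A ⊗[ℂ] A)) embed)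

/-- `ι ⊗ Δ : A ⊗ A → M(A ⊗ A ⊗ A)`. -/
def idTensorCoprod : A ⊗[ℂ] A →ₗ[ℂ] Multiplier (A ⊗[ℂ] (A ⊗[ℂ] A)) :=
  TensorProduct.lift (tens.compl₁₂ embed (Δ : A →ₗ[ℂ] Multiplier (A ⊗[ℂ] A)))

/-- `Δ` is a coproduct on the (non-degenerate) algebra `A`. -/
structure IsCoproduct : Prop where
  covered_right : ∀ a b : A,
    Δ a * tens 1 (embed b) ∈ LinearMap.range (embed : A ⊗[ℂ] A →ₗ[ℂ] _)
  covered_left : ∀ a b : A,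
    tens (embed a) 1 * Δ b ∈ LinearMap.range (embed : A ⊗[ℂ] A →ₗ[ℂ] _)
  coassoc : ∀ a b c : A,
    tens (embed c) 1 * coprodTensorId Δ (T₁ Δ (a ⊗ₜ b)) =
      idTensorCoprod Δ (T₂ Δ (c ⊗ₜ a)) * tens 1 (tens 1 (embed b))

/-- The coproduct is full: the only subspaces `V`, `W` of `A` with `Δ(A)(1 ⊗ A) ⊆ V ⊗ A` and
`(A ⊗ 1)Δ(A) ⊆ A ⊗ W` are `V = A` and `W = A`. -/
def IsFull : Prop :=
  (∀ V : Submodule ℂ A,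
    LinearMap.range (T₁ Δ) ≤ LinearMap.range (LinearMap.rTensor A V.subtype) → V = ⊤) ∧
  (∀ W : Submodule ℂ A,
    LinearMap.range (T₂ Δ) ≤ LinearMap.range (LinearMap.lTensor A W.subtype) → W = ⊤)

/-- `ε` is a counit for `Δ`. -/
def IsCounit (ε : A →ₗ[ℂ] ℂ) : Prop :=
  (∀ a b : A, TensorProduct.lid ℂ A (LinearMap.rTensor A ε (T₁ Δ (a ⊗ₜ b))) = a * b) ∧
  (∀ a b : A, TensorProduct.rid ℂ A (LinearMap.lTensor A ε (T₂ Δ (a ⊗ₜ b))) = a * b)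

/-- `E` is an idempotent giving the ranges of the canonical maps:
`E(A ⊗ A) = T₁(A ⊗ A)` and `(A ⊗ A)E = T₂(A ⊗ A)`. There is at most one such `E`. -/
structure IsCanonicalIdempotent (E : Multiplier (A ⊗[ℂ] A)) : Prop where
  idem : E * E = E
  range_left : LinearMap.range E.left = LinearMap.range (T₁ Δ)
  range_right : LinearMap.range E.right = LinearMap.range (T₂ Δ)

/-- `n` is the value at `m ∈ M(B)` of the extension to `M(B)` of a homomorphism `φ : B → M(C)`,
where the extension is normalized to have the value `e` at `1`. (If
`φ(B)C = eC` and `Cφ(B) = Ce`, then `n` is determined by these conditions.) -/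
def IsExtensionValue {B C : Type*}
    [NonUnitalRing B] [Module ℂ B] [IsScalarTower ℂ B B] [SMulCommClass ℂ B B]
    [NonUnitalRing C] [Module ℂ C] [IsScalarTower ℂ C C] [SMulCommClass ℂ C C]
    (φ : B →ₗ[ℂ] Multiplier C) (e : Multiplier C) (m : Multiplier B) (n : Multiplier C) : Prop :=
  e * n = n ∧ n * e = n ∧
    (∀ x, n * φ x = φ (m.left x)) ∧ (∀ x, φ x * n = φ (m.right x))

/-- `E ⊗ 1` in `M(A ⊗ A ⊗ A)`. -/
def tensOne (E : Multiplier (A ⊗[ℂ] A)) : Multiplier (A ⊗[ℂ] (A ⊗[ℂ] A)) :=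
  transport (TensorProduct.assoc ℂ A A A) assoc_mul (tens E 1)

/-- `1 ⊗ E` in `M(A ⊗ A ⊗ A)`. -/
def oneTens (E : Multiplier (A ⊗[ℂ] A)) : Multiplier (A ⊗[ℂ] (A ⊗[ℂ] A)) := tens 1 E

/-- `Δ₁₃(a)` in `M(A ⊗ A ⊗ A)`. -/
def coprod13 (a : A) : Multiplier (A ⊗[ℂ] (A ⊗[ℂ] A)) := transport leg13 leg13_mul (tens (Δ a) 1)

/-- `G ⊗ ι` on `A ⊗ A ⊗ A`. -/
def onLegs12 (G : A ⊗[ℂ] A →ₗ[ℂ] A ⊗[ℂ] A) : A ⊗[ℂ] (A ⊗[ℂ] A) →ₗ[ℂ] A ⊗[ℂ] (A ⊗[ℂ] A) :=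
  (TensorProduct.assoc ℂ A A A).toLinearMap ∘ₗ LinearMap.rTensor A G ∘ₗ
    (TensorProduct.assoc ℂ A A A).symm.toLinearMap

/-- `(G₁ ⊗ ι)(Δ₁₃(a)(1 ⊗ b ⊗ c)) = Δ₁₃(a)(1 ⊗ E)(1 ⊗ b ⊗ c)`; the element
`Δ₁₃(a)(1 ⊗ b ⊗ c)` of `A ⊗ A ⊗ A` is `Δ(a)(1 ⊗ c)` in the legs 1, 3 and `b` in the leg 2. -/
def IsG₁ (E : Multiplier (A ⊗[ℂ] A)) (G : A ⊗[ℂ] A →ₗ[ℂ] A ⊗[ℂ] A) : Prop :=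
  ∀ a b c : A, embed (onLegs12 G (leg13 (T₁ Δ (a ⊗ₜ c) ⊗ₜ b))) =
    coprod13 Δ a * oneTens E * tens 1 (tens (embed b) (embed c))

/-- `(ι ⊗ G₂)((a ⊗ b ⊗ 1)Δ₁₃(c)) = (a ⊗ b ⊗ 1)(E ⊗ 1)Δ₁₃(c)`; the element
`(a ⊗ b ⊗ 1)Δ₁₃(c)` of `A ⊗ A ⊗ A` is `(a ⊗ 1)Δ(c)` in the legs 1, 3 and `b` in the leg 2. -/
def IsG₂ (E : Multiplier (A ⊗[ℂ] A)) (G : A ⊗[ℂ] A →ₗ[ℂ] A ⊗[ℂ] A) : Prop :=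
  ∀ a b c : A, embed (LinearMap.lTensor A G (leg13 (T₂ Δ (a ⊗ₜ c) ⊗ₜ b))) =
    tens (embed a) (tens (embed b) 1) * tensOne E * coprod13 Δ c

/-- `(A, Δ)` is a weak multiplier Hopf algebra. -/
structure IsWeakMultiplierHopfAlgebra : Prop where
  nondegenerate : IsNondegenerateAlgebra A
  idempotent : IsIdempotentAlgebra A
  coproduct : IsCoproduct Δ
  full : IsFull Δ
  counit : ∃ ε : A →ₗ[ℂ] ℂ, IsCounit Δ ε
  canonical : ∃ E : Multiplier (A ⊗[ℂ] A), IsCanonicalIdempotent Δ E ∧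
    -- `(ι ⊗ Δ)E = (E ⊗ 1)(1 ⊗ E) = (1 ⊗ E)(E ⊗ 1)`
    IsExtensionValue (idTensorCoprod Δ) (oneTens E) E (tensOne E * oneTens E) ∧
    tensOne E * oneTens E = oneTens E * tensOne E ∧
    (∃ G₁, IsG₁ Δ E G₁ ∧ LinearMap.ker (T₁ Δ) = LinearMap.range (LinearMap.id - G₁)) ∧
    (∃ G₂, IsG₂ Δ E G₂ ∧ LinearMap.ker (T₂ Δ) = LinearMap.range (LinearMap.id - G₂))

/-- The opposite coproduct `Δ^cop`. -/
def cop : A →ₙₐ[ℂ] Multiplier (A ⊗[ℂ] A) :=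
  (transport (TensorProduct.comm ℂ A A) comm_mul : _ →ₙₐ[ℂ] _).comp Δ

/-- `(A, Δ)` is a regular weak multiplier Hopf algebra. -/
structure IsRegularWeakMultiplierHopfAlgebra : Prop where
  weak : IsWeakMultiplierHopfAlgebra Δ
  regular_left : ∀ a b : A,
    Δ a * tens (embed b) 1 ∈ LinearMap.range (embed : A ⊗[ℂ] A →ₗ[ℂ] _)
  regular_right : ∀ a b : A,
    tens 1 (embed a) * Δ b ∈ LinearMap.range (embed : A ⊗[ℂ] A →ₗ[ℂ] _)
  weak_cop : IsWeakMultiplierHopfAlgebra (cop Δ)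

end Coproducts

section Modules

variable {B : Type*} [NonUnitalRing B] [Module ℂ B] [IsScalarTower ℂ B B] [SMulCommClass ℂ B B]
  {V : Type*} [AddCommGroup V] [Module ℂ V]

/-- The left `B`-module `V` is unital: `BV = V`. -/
def IsUnitalModule (ρ : B →ₙₐ[ℂ] Module.End ℂ V) : Prop :=
  Submodule.span ℂ {x : V | ∃ b v, x = ρ b v} = ⊤

open Classical in
/-- The action of `M(B)` that extends the action of `B` on a unital, non-degenerate module `V`:
`m(bv) = (mb)v`. -/
def extendedAction (ρ : B →ₙₐ[ℂ] Module.End ℂ V) (m : Multiplier B) : Module.End ℂ V :=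
  if h : ∃ f : Module.End ℂ V, ∀ b v, f (ρ b v) = ρ (m.left b) v then h.choose else 0

theorem extendedAction_apply (ρ : B →ₙₐ[ℂ] Module.End ℂ V) (hu : IsUnitalModule ρ)
    (hn : ∀ v, (∀ b, ρ b v = 0) → v = 0) (m : Multiplier B) (b : B) (v : V) :
    extendedAction ρ m (ρ b v) = ρ (m.left b) v := by
  have h : ∃ f : Module.End ℂ V, ∀ b v, f (ρ b v) = ρ (m.left b) v := by
    let p : B ⊗[ℂ] V →ₗ[ℂ] V := TensorProduct.lift (ρ : B →ₗ[ℂ] Module.End ℂ V)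
    let q : B ⊗[ℂ] V →ₗ[ℂ] V := p ∘ₗ LinearMap.rTensor V m.left
    have hp : LinearMap.range p = ⊤ := by
      rw [eq_top_iff, ← hu, Submodule.span_le]
      rintro _ ⟨b, v, rfl⟩
      exact ⟨b ⊗ₜ v, rfl⟩
    have key : ∀ c t, ρ c (q t) = ρ (m.right c) (p t) := by
      intro c t
      induction t using TensorProduct.induction_on with
      | zero => simp
      | add x y hx hy => simp only [map_add, hx, hy]
      | tmul b v =>
        change ρ c (ρ (m.left b) v) = ρ (m.right c) (ρ b v)
        rw [← Module.End.mul_apply, ← map_mul, ← Module.End.mul_apply, ← map_mul]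
        exact congrArg (fun x => ρ x v) (m.2.2.2 c b).symm
    obtain ⟨s, hs⟩ := p.exists_rightInverse_of_surjective hp
    refine ⟨q ∘ₗ s, fun b v => ?_⟩
    have : q (s (ρ b v)) - q (b ⊗ₜ v) = 0 := by
      refine hn _ fun c => ?_
      have h1 : p (s (ρ b v)) = ρ b v := LinearMap.congr_fun hs _
      rw [map_sub, key, key, h1]
      exact sub_self _
    exact sub_eq_zero.1 this
  rw [extendedAction, dif_pos h]
  exact h.choose_spec b v

variable {C : Type*} [NonUnitalRing C] [Module ℂ C] [IsScalarTower ℂ C C] [SMulCommClass ℂ C C]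
  {W : Type*} [AddCommGroup W] [Module ℂ W]

/-- The action of `B ⊗ C` on `V ⊗ W`: `(b ⊗ c)(v ⊗ w) = bv ⊗ cw`. -/
def tensorAction (ρ : B →ₙₐ[ℂ] Module.End ℂ V) (σ : C →ₙₐ[ℂ] Module.End ℂ W) :
    B ⊗[ℂ] C →ₙₐ[ℂ] Module.End ℂ (V ⊗[ℂ] W) :=
  { TensorProduct.homTensorHomMap (RingHom.id ℂ) V W V W ∘ₗ
      TensorProduct.map (ρ : B →ₗ[ℂ] Module.End ℂ V) (σ : C →ₗ[ℂ] Module.End ℂ W) with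
    map_zero' := map_zero _
    map_mul' := fun x y => by
      change (TensorProduct.homTensorHomMap (RingHom.id ℂ) V W V W ∘ₗ
          TensorProduct.map (ρ : B →ₗ[ℂ] Module.End ℂ V) (σ : C →ₗ[ℂ] Module.End ℂ W)) (x * y) =
        (TensorProduct.homTensorHomMap (RingHom.id ℂ) V W V W ∘ₗ
          TensorProduct.map (ρ : B →ₗ[ℂ] Module.End ℂ V) (σ : C →ₗ[ℂ] Module.End ℂ W)) x *
        (TensorProduct.homTensorHomMap (RingHom.id ℂ) V W V W ∘ₗ
          TensorProduct.map (ρ : B →ₗ[ℂ] Module.End ℂ V) (σ : C →ₗ[ℂ] Module.End ℂ W)) y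
      induction x using TensorProduct.induction_on with
      | zero => simp
      | add x x' hx hx' => simp only [add_mul, map_add, hx, hx']
      | tmul b c =>
        induction y using TensorProduct.induction_on with
        | zero => simp
        | add y y' hy hy' => simp only [mul_add, map_add, hy, hy']
        | tmul b' c' =>
          ext v w
          simp }

theorem tensorAction_tmul (ρ : B →ₙₐ[ℂ] Module.End ℂ V) (σ : C →ₙₐ[ℂ] Module.End ℂ W)
    (b : B) (c : C) (v : V) (w : W) :
    tensorAction ρ σ (b ⊗ₜ c) (v ⊗ₜ w) = ρ b v ⊗ₜ σ c w := rfl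

/-- The action of `B` on itself by left multiplication. -/
def leftRegular : B →ₙₐ[ℂ] Module.End ℂ B := NonUnitalAlgHom.lmul ℂ B

end Modules

section Smash

variable {A : Type*} [NonUnitalRing A] [Module ℂ A] [IsScalarTower ℂ A A] [SMulCommClass ℂ A A]
  {R : Type*} [NonUnitalRing R] [Module ℂ R] [IsScalarTower ℂ R R] [SMulCommClass ℂ R R]

/-- `R`, with the action `act` of `A`, is a left `A`-module algebra: a unital left `A`-module with
`a ▷ (xy) = m(Δ(a) ▷ (x ⊗ y))`, where `m` is the product of `R`. -/
structure IsModuleAlgebra (Δ : A →ₙₐ[ℂ] Multiplier (A ⊗[ℂ] A))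
    (act : A →ₙₐ[ℂ] Module.End ℂ R) : Prop where
  unital : IsUnitalModule act
  act_mul : ∀ (a : A) (x y : R), act a (x * y) =
    LinearMap.mul' ℂ R (extendedAction (tensorAction act act) (Δ a) (x ⊗ₜ y))

/-- The linear map `(r ⊗ s) ⊗ (p ⊗ q) ↦ r(p ▷ s) ⊗ q`. -/
def smashAux (act : A →ₙₐ[ℂ] Module.End ℂ R) :
    (R ⊗[ℂ] R) ⊗[ℂ] (A ⊗[ℂ] A) →ₗ[ℂ] R ⊗[ℂ] A :=
  TensorProduct.lift (TensorProduct.lift (LinearMap.mk₂ ℂ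
    (fun r s => LinearMap.rTensor A
      (LinearMap.mulLeft ℂ r ∘ₗ (act : A →ₗ[ℂ] Module.End ℂ R).flip s))
    (fun r r' s => by ext; simp [add_mul, TensorProduct.add_tmul])
    (fun c r s => by ext; simp [smul_mul_assoc, TensorProduct.smul_tmul'])
    (fun r s s' => by ext; simp [mul_add, TensorProduct.add_tmul])
    (fun c r s => by ext; simp [TensorProduct.smul_tmul'])))

/-- The product of `R # A`: `(r ⊗ a)(s ⊗ b) = ∑ r(a₍₁₎ ▷ s) ⊗ a₍₂₎b`, where
`∑ a₍₁₎ ⊗ a₍₂₎b` is the element `Δ(a)(1 ⊗ b)` of `A ⊗ A`. -/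
def smashMul (Δ : A →ₙₐ[ℂ] Multiplier (A ⊗[ℂ] A)) (act : A →ₙₐ[ℂ] Module.End ℂ R) :
    R ⊗[ℂ] A →ₗ[ℂ] R ⊗[ℂ] A →ₗ[ℂ] R ⊗[ℂ] A :=
  TensorProduct.curry (smashAux act ∘ₗ LinearMap.lTensor (R ⊗[ℂ] R) (T₁ Δ) ∘ₗ
    (TensorProduct.tensorTensorTensorComm ℂ R A R A).toLinearMap)

theorem smashMul_tmul (Δ : A →ₙₐ[ℂ] Multiplier (A ⊗[ℂ] A)) (act : A →ₙₐ[ℂ] Module.End ℂ R)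
    (r s : R) (a b : A) {ι : Type*} (t : Finset ι) (p q : ι → A)
    (h : T₁ Δ (a ⊗ₜ b) = ∑ i ∈ t, p i ⊗ₜ q i) :
    smashMul Δ act (r ⊗ₜ a) (s ⊗ₜ b) = ∑ i ∈ t, (r * act (p i) s) ⊗ₜ q i := by
  simp [smashMul, smashAux, h, TensorProduct.tmul_sum]

/-- The action of `A ⊗ A` on `R # A`: `(p ⊗ q) ▷ (r # a) = (p ▷ r) # qa`. -/
def smashAction (act : A →ₙₐ[ℂ] Module.End ℂ R) :
    A ⊗[ℂ] A →ₙₐ[ℂ] Module.End ℂ (R ⊗[ℂ] A) :=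
  tensorAction act leftRegular

/-- The operator `x ↦ m ▷ x` on `R # A`, for `m ∈ M(A ⊗ A)`. -/
def smashExt (act : A →ₙₐ[ℂ] Module.End ℂ R) (m : Multiplier (A ⊗[ℂ] A)) :
    Module.End ℂ (R ⊗[ℂ] A) :=
  extendedAction (smashAction act) m

/-- The subspace `R #_E A = E ▷ (R # A)` of `R # A`. -/
def smashProduct (act : A →ₙₐ[ℂ] Module.End ℂ R) (E : Multiplier (A ⊗[ℂ] A)) :
    Submodule ℂ (R ⊗[ℂ] A) :=
  LinearMap.range (smashExt act E)

end Smash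

end WMHA

end

/-!
The product of `R # A` is `(r ⊗ a) y = m₁₂(r ⊗ Δ(a) ▷ y)`, where `m₁₂(r ⊗ (s ⊗ b)) = rs ⊗ b`, so
associativity reduces to `Δ(a) ▷ (y z) = (Δ(a) ▷ y) z`. Everything about `E` comes from
`m(E ▷ ξ) = m(ξ)` for the product `m` of `R`, which holds because it holds after acting with any
`a ∈ A`. Together with the formula for `(ι ⊗ Δ)E` it gives `(E ▷ x) y = x y`, and `E ▷ (x y) = x y`
follows since `E ▷ x` is a combination of elements `Δ(a) ▷ x'`.

If `y x = 0` for all `y`, then `Δ(a) ▷ x = 0` for all `a` because `R` is non-degenerate, hence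
`E ▷ x = 0`. For the other side, `Γ : b ⊗ t ↦ b₁ ▷ t ⊗ b₂` maps `A ⊗ R` onto `E ▷ (R # A)`, and
`Γ(z) (s ⊗ c)` is `Γ(zs) (1 ⊗ c)`. So if `Γ(z) y = 0` for all `y`, then `Γ(zs) = 0` for all
`s ∈ R`. The kernel of `Γ` is that of a projection obtained from the map `G₁` of `Δ^cop`, and this
projection commutes with right multiplication by `s`, again because `m(E ▷ ξ) = m(ξ)`.
Non-degeneracy of `R` then gives `Γ(z) = 0`.

All module elements are treated through local units: `G₁` also shows that every `z ∈ A` satisfies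
`e z = z` for some `e ∈ A`, so that `a ▷ v` can be replaced by `a e ▷ v` in a unital module and the
action of `M(A ⊗ A)` is defined by its values on `A ⊗ A`.
-/

noncomputable section

namespace WMHA

section Slices

variable {V V' W W' : Type*} [AddCommGroup V] [Module ℂ V] [AddCommGroup V'] [Module ℂ V']
  [AddCommGroup W] [Module ℂ W] [AddCommGroup W'] [Module ℂ W']

/-- The slice map `ι ⊗ ω : V ⊗ W → V`. -/
def sliceRight (ω : W →ₗ[ℂ] ℂ) : V ⊗[ℂ] W →ₗ[ℂ] V :=
  (TensorProduct.rid ℂ V).toLinearMap ∘ₗ LinearMap.lTensor V ω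

/-- The slice map `ω ⊗ ι : W ⊗ V → V`. -/
def sliceLeft (ω : W →ₗ[ℂ] ℂ) : W ⊗[ℂ] V →ₗ[ℂ] V :=
  (TensorProduct.lid ℂ V).toLinearMap ∘ₗ LinearMap.rTensor V ω

theorem sliceRight_tmul (ω : W →ₗ[ℂ] ℂ) (v : V) (w : W) : sliceRight ω (v ⊗ₜ w) = ω w • v := by
  simp [sliceRight]

theorem sliceLeft_tmul (ω : W →ₗ[ℂ] ℂ) (v : V) (w : W) : sliceLeft ω (w ⊗ₜ v) = ω w • v := by
  simp [sliceLeft]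

theorem sliceRight_rTensor (ω : W →ₗ[ℂ] ℂ) (f : V →ₗ[ℂ] V') (t : V ⊗[ℂ] W) :
    sliceRight ω (LinearMap.rTensor W f t) = f (sliceRight ω t) := by
  induction t with
  | zero => simp only [map_zero]
  | add s t hs ht => simp only [map_add, hs, ht]
  | tmul v w => simp only [LinearMap.rTensor_tmul, sliceRight_tmul, map_smul]

theorem lTensor_sliceRight_assoc_tmul (ω : W →ₗ[ℂ] ℂ) (t : V ⊗[ℂ] V') (w : W) :
    LinearMap.lTensor V (sliceRight ω) (TensorProduct.assoc ℂ V V' W (t ⊗ₜ w)) = ω w • t := by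
  induction t with
  | zero => simp
  | add s t hs ht => simp only [TensorProduct.add_tmul, map_add, hs, ht, smul_add]
  | tmul v v' => simp [sliceRight_tmul]

theorem lTensor_sliceLeft_assoc_tmul (ω : W →ₗ[ℂ] ℂ) (t : V ⊗[ℂ] W) (v' : V') :
    LinearMap.lTensor V (sliceLeft ω) (TensorProduct.assoc ℂ V W V' (t ⊗ₜ v')) =
      sliceRight ω t ⊗ₜ v' := by
  induction t with
  | zero => simp
  | add s t hs ht => simp only [TensorProduct.add_tmul, map_add, hs, ht]
  | tmul v w => simp [sliceRight_tmul, sliceLeft_tmul, TensorProduct.smul_tmul]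

theorem eq_zero_of_forall_rTensor {ι : Type*} (f : ι → V →ₗ[ℂ] V')
    (hf : ∀ v, (∀ i, f i v = 0) → v = 0) (t : V ⊗[ℂ] W)
    (h : ∀ i, LinearMap.rTensor W (f i) t = 0) : t = 0 := by
  classical
  let b := Module.Basis.ofVectorSpace ℂ W
  apply (TensorProduct.equivFinsuppOfBasisRight b).injective
  ext j
  have slice_eq : TensorProduct.equivFinsuppOfBasisRight b t j = sliceRight (b.coord j) t :=
    TensorProduct.equivFinsuppOfBasisRight_apply ..
  rw [slice_eq, map_zero, Finsupp.zero_apply]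
  exact hf _ fun i => by rw [← sliceRight_rTensor, h i, map_zero]

theorem comm_rTensor (f : V →ₗ[ℂ] V') (t : V ⊗[ℂ] W) :
    TensorProduct.comm ℂ V' W (LinearMap.rTensor W f t) =
      LinearMap.lTensor W f (TensorProduct.comm ℂ V W t) := by
  simp [← LinearMap.comm_comp_rTensor_comp_comm_eq]

theorem comm_lTensor (f : V →ₗ[ℂ] V') (t : W ⊗[ℂ] V) :
    TensorProduct.comm ℂ W V' (LinearMap.lTensor W f t) =
      LinearMap.rTensor W f (TensorProduct.comm ℂ W V t) := by
  simp [← LinearMap.comm_comp_lTensor_comp_comm_eq]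

theorem eq_zero_of_forall_lTensor {ι : Type*} (f : ι → V →ₗ[ℂ] V')
    (hf : ∀ v, (∀ i, f i v = 0) → v = 0) (t : W ⊗[ℂ] V)
    (h : ∀ i, LinearMap.lTensor W (f i) t = 0) : t = 0 := by
  apply (TensorProduct.comm ℂ W V).injective
  rw [map_zero]
  exact eq_zero_of_forall_rTensor f hf _ fun i => by rw [← comm_lTensor, h, map_zero]

end Slices

section NondegenerateAlgebras

variable {A : Type*} [NonUnitalRing A]

theorem IsNondegenerateAlgebra.eq_of_mul_right (hA : IsNondegenerateAlgebra A) {a b : A}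
    (h : ∀ c, a * c = b * c) : a = b :=
  sub_eq_zero.1 <| hA.1 _ fun c => by rw [sub_mul, h, sub_self]

theorem IsNondegenerateAlgebra.eq_of_mul_left (hA : IsNondegenerateAlgebra A) {a b : A}
    (h : ∀ c, c * a = c * b) : a = b :=
  sub_eq_zero.1 <| hA.2 _ fun c => by rw [mul_sub, h, sub_self]

variable [Module ℂ A] [SMulCommClass ℂ A A]

theorem IsNondegenerateAlgebra.eq_of_rTensor_mulLeft (hA : IsNondegenerateAlgebra A)
    {W : Type*} [AddCommGroup W] [Module ℂ W] {s t : A ⊗[ℂ] W}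
    (h : ∀ a, LinearMap.rTensor W (LinearMap.mulLeft ℂ a) s =
      LinearMap.rTensor W (LinearMap.mulLeft ℂ a) t) : s = t :=
  sub_eq_zero.1 <| eq_zero_of_forall_rTensor (LinearMap.mulLeft ℂ) hA.2 _ fun a => by
    rw [map_sub, h, sub_self]

variable [IsScalarTower ℂ A A]
variable {B : Type*} [NonUnitalRing B] [Module ℂ B] [IsScalarTower ℂ B B] [SMulCommClass ℂ B B]

theorem mul_tmul_eq_map (t : A ⊗[ℂ] B) (a : A) (b : B) :
    t * a ⊗ₜ[ℂ] b = TensorProduct.map (LinearMap.mulRight ℂ a) (LinearMap.mulRight ℂ b) t := by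
  induction t with
  | zero => simp only [zero_mul, map_zero]
  | add s t hs ht => simp only [add_mul, map_add, hs, ht]
  | tmul x y => simp

theorem tmul_mul_eq_map (t : A ⊗[ℂ] B) (a : A) (b : B) :
    a ⊗ₜ[ℂ] b * t = TensorProduct.map (LinearMap.mulLeft ℂ a) (LinearMap.mulLeft ℂ b) t := by
  induction t with
  | zero => simp only [mul_zero, map_zero]
  | add s t hs ht => simp only [mul_add, map_add, hs, ht]
  | tmul x y => simp

theorem IsNondegenerateAlgebra.tensor (hA : IsNondegenerateAlgebra A)
    (hB : IsNondegenerateAlgebra B) : IsNondegenerateAlgebra (A ⊗[ℂ] B) := by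
  constructor <;> intro t h
  · refine eq_zero_of_forall_rTensor (LinearMap.mulRight ℂ) hA.1 t fun a =>
      eq_zero_of_forall_lTensor (LinearMap.mulRight ℂ) hB.1 _ fun b => ?_
    rw [← LinearMap.comp_apply, LinearMap.lTensor_comp_rTensor, ← mul_tmul_eq_map, h]
  · refine eq_zero_of_forall_rTensor (LinearMap.mulLeft ℂ) hA.2 t fun a =>
      eq_zero_of_forall_lTensor (LinearMap.mulLeft ℂ) hB.2 _ fun b => ?_
    rw [← LinearMap.comp_apply, LinearMap.lTensor_comp_rTensor, ← tmul_mul_eq_map, h]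

end NondegenerateAlgebras

section Multipliers

variable {A : Type*} [NonUnitalRing A] [Module ℂ A] [IsScalarTower ℂ A A] [SMulCommClass ℂ A A]
variable {B : Type*} [NonUnitalRing B] [Module ℂ B] [IsScalarTower ℂ B B] [SMulCommClass ℂ B B]

namespace Multiplier

theorem ext {m n : Multiplier A} (hl : m.left = n.left) (hr : m.right = n.right) : m = n :=
  Subtype.ext (Prod.ext hl (MulOpposite.unop_injective hr))

theorem left_mul (m : Multiplier A) (x y : A) : m.left (x * y) = m.left x * y := m.2.1 x y

theorem right_mul (m : Multiplier A) (x y : A) : m.right (x * y) = x * m.right y := m.2.2.1 x y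

theorem right_mul_eq (m : Multiplier A) (x y : A) : m.right x * y = x * m.left y := m.2.2.2 x y

theorem mul_left_apply (m n : Multiplier A) (x : A) : (m * n).left x = m.left (n.left x) := rfl

theorem mul_right_apply (m n : Multiplier A) (x : A) : (m * n).right x = n.right (m.right x) := rfl

theorem left_injective (hA : IsNondegenerateAlgebra A) {m n : Multiplier A}
    (h : ∀ x, m.left x = n.left x) : m = n :=
  ext (LinearMap.ext h) <| LinearMap.ext fun x => hA.eq_of_mul_right fun y => by
    rw [right_mul_eq, right_mul_eq, h]

theorem right_injective (hA : IsNondegenerateAlgebra A) {m n : Multiplier A}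
    (h : ∀ x, m.right x = n.right x) : m = n :=
  left_injective hA fun x => hA.eq_of_mul_left fun y => by
    rw [← right_mul_eq, ← right_mul_eq, h]

theorem left_right_comm (hA : IsNondegenerateAlgebra A) (m n : Multiplier A) (x : A) :
    m.left (n.right x) = n.right (m.left x) :=
  hA.eq_of_mul_right fun y => by
    rw [← left_mul, right_mul_eq, right_mul_eq, left_mul]

theorem left_rTensor_mulRight (h : IsNondegenerateAlgebra (A ⊗[ℂ] B))
    (m : Multiplier (A ⊗[ℂ] B)) (a : A) (t : A ⊗[ℂ] B) :
    m.left (LinearMap.rTensor B (LinearMap.mulRight ℂ a) t) =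
      LinearMap.rTensor B (LinearMap.mulRight ℂ a) (m.left t) :=
  m.left_right_comm h (tens (embed a) 1) t

theorem left_lTensor_mulRight (h : IsNondegenerateAlgebra (A ⊗[ℂ] B))
    (m : Multiplier (A ⊗[ℂ] B)) (b : B) (t : A ⊗[ℂ] B) :
    m.left (LinearMap.lTensor A (LinearMap.mulRight ℂ b) t) =
      LinearMap.lTensor A (LinearMap.mulRight ℂ b) (m.left t) :=
  m.left_right_comm h (tens 1 (embed b)) t

theorem right_lTensor_mulLeft (h : IsNondegenerateAlgebra (A ⊗[ℂ] B))
    (m : Multiplier (A ⊗[ℂ] B)) (b : B) (t : A ⊗[ℂ] B) :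
    m.right (LinearMap.lTensor A (LinearMap.mulLeft ℂ b) t) =
      LinearMap.lTensor A (LinearMap.mulLeft ℂ b) (m.right t) :=
  ((tens 1 (embed b)).left_right_comm h m t).symm

theorem mul_embed (m : Multiplier A) (x : A) : m * embed x = embed (m.left x) :=
  ext (LinearMap.ext (m.left_mul x)) (LinearMap.ext fun y => m.right_mul_eq y x)

theorem embed_mul (m : Multiplier A) (x : A) : embed x * m = embed (m.right x) :=
  ext (LinearMap.ext fun y => (m.right_mul_eq x y).symm) (LinearMap.ext fun y => m.right_mul y x)

end Multiplier

theorem embed_left (a x : A) : (embed a).left x = a * x := rfl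

theorem embed_right (a x : A) : (embed a).right x = x * a := rfl

theorem embed_injective (hA : IsNondegenerateAlgebra A) {a b : A}
    (h : (embed a : Multiplier A) = embed b) : a = b :=
  hA.eq_of_mul_right fun c => congrArg (fun m : Multiplier A => m.left c) h

theorem tens_mul_tens (m m' : Multiplier A) (n n' : Multiplier B) :
    tens m n * tens m' n' = tens (m * m') (n * n') :=
  Multiplier.ext (TensorProduct.map_comp m.left n.left m'.left n'.left).symm
    (TensorProduct.map_comp m'.right n'.right m.right n.right).symm

theorem tens_embed_embed (a : A) (b : B) : tens (embed a) (embed b) = embed (a ⊗ₜ[ℂ] b) :=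
  Multiplier.ext (LinearMap.ext fun t => (tmul_mul_eq_map t a b).symm)
    (LinearMap.ext fun t => (mul_tmul_eq_map t a b).symm)

theorem transport_left (e : A ≃ₗ[ℂ] B) (he : ∀ x y, e (x * y) = e x * e y) (m : Multiplier A)
    (x : A) : (transport e he m).left (e x) = e (m.left x) :=
  congrArg (fun y => e (m.left y)) (e.symm_apply_apply x)

theorem transport_embed (e : A ≃ₗ[ℂ] B) (he : ∀ x y, e (x * y) = e x * e y) (a : A) :
    transport e he (embed a) = embed (e a) := by
  refine Multiplier.ext (LinearMap.ext fun y => ?_) (LinearMap.ext fun y => ?_)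
  · exact (he a (e.symm y)).trans (by rw [e.apply_symm_apply, embed_left])
  · exact (he (e.symm y) a).trans (by rw [e.apply_symm_apply, embed_right])

end Multipliers

section CanonicalMaps

variable {A : Type*} [NonUnitalRing A] [Module ℂ A] [IsScalarTower ℂ A A] [SMulCommClass ℂ A A]
  {Δ : A →ₙₐ[ℂ] Multiplier (A ⊗[ℂ] A)}

theorem embed_T₁ (hN : IsNondegenerateAlgebra A) (hc : IsCoproduct Δ) (a b : A) :
    embed (T₁ Δ (a ⊗ₜ b)) = Δ a * tens 1 (embed b) :=
  embed_unembed (hN.tensor hN) (hc.covered_right a b)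

theorem embed_T₂ (hN : IsNondegenerateAlgebra A) (hc : IsCoproduct Δ) (a b : A) :
    embed (T₂ Δ (a ⊗ₜ b)) = tens (embed a) 1 * Δ b :=
  embed_unembed (hN.tensor hN) (hc.covered_left a b)

theorem coproduct_left_tmul (hN : IsNondegenerateAlgebra A) (hc : IsCoproduct Δ) (a x b : A) :
    (Δ a).left (x ⊗ₜ b) = LinearMap.rTensor A (LinearMap.mulRight ℂ x) (T₁ Δ (a ⊗ₜ b)) := by
  change _ = (tens (embed x) (1 : Multiplier A)).right (T₁ Δ (a ⊗ₜ b))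
  apply embed_injective (hN.tensor hN)
  rw [← Multiplier.mul_embed, ← Multiplier.embed_mul, embed_T₁ hN hc, mul_assoc, tens_mul_tens,
    one_mul, mul_one, tens_embed_embed]

theorem coproduct_right_tmul (hN : IsNondegenerateAlgebra A) (hc : IsCoproduct Δ) (a x b : A) :
    (Δ a).right (x ⊗ₜ b) = LinearMap.lTensor A (LinearMap.mulLeft ℂ b) (T₂ Δ (x ⊗ₜ a)) := by
  change _ = (tens (1 : Multiplier A) (embed b)).left (T₂ Δ (x ⊗ₜ a))
  apply embed_injective (hN.tensor hN)
  rw [← Multiplier.mul_embed, ← Multiplier.embed_mul, embed_T₂ hN hc, ← mul_assoc, tens_mul_tens,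
    one_mul, mul_one, tens_embed_embed]

theorem T₁_lTensor_mulRight (hN : IsNondegenerateAlgebra A) (hc : IsCoproduct Δ) (c : A)
    (t : A ⊗[ℂ] A) : T₁ Δ (LinearMap.lTensor A (LinearMap.mulRight ℂ c) t) =
      LinearMap.lTensor A (LinearMap.mulRight ℂ c) (T₁ Δ t) := by
  induction t with
  | zero => simp only [map_zero]
  | add s t hs ht => simp only [map_add, hs, ht]
  | tmul a b =>
    change _ = (tens (1 : Multiplier A) (embed c)).right (T₁ Δ (a ⊗ₜ b))
    apply embed_injective (hN.tensor hN)
    rw [← Multiplier.embed_mul, LinearMap.lTensor_tmul, LinearMap.mulRight_apply, embed_T₁ hN hc,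
      embed_T₁ hN hc, mul_assoc, tens_mul_tens, one_mul, Multiplier.mul_embed, embed_left]

theorem T₁_mul_tmul (hN : IsNondegenerateAlgebra A) (hc : IsCoproduct Δ) (u a b : A) :
    T₁ Δ ((u * a) ⊗ₜ b) = (Δ u).left (T₁ Δ (a ⊗ₜ b)) := by
  apply embed_injective (hN.tensor hN)
  rw [embed_T₁ hN hc, ← Multiplier.mul_embed, embed_T₁ hN hc, map_mul, mul_assoc]

theorem rTensor_mulLeft_T₁ (hN : IsNondegenerateAlgebra A) (hc : IsCoproduct Δ) (c a b : A) :
    LinearMap.rTensor A (LinearMap.mulLeft ℂ c) (T₁ Δ (a ⊗ₜ b)) =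
      LinearMap.lTensor A (LinearMap.mulRight ℂ b) (T₂ Δ (c ⊗ₜ a)) := by
  change (tens (embed c) (1 : Multiplier A)).left (T₁ Δ (a ⊗ₜ b)) =
    (tens (1 : Multiplier A) (embed b)).right (T₂ Δ (c ⊗ₜ a))
  apply embed_injective (hN.tensor hN)
  rw [← Multiplier.mul_embed, ← Multiplier.embed_mul, embed_T₁ hN hc, embed_T₂ hN hc, mul_assoc]

theorem left_T₁_of_mul_coproduct (hN : IsNondegenerateAlgebra A) (hc : IsCoproduct Δ)
    {F : Multiplier (A ⊗[ℂ] A)} (hF : ∀ a, F * Δ a = Δ a) (t : A ⊗[ℂ] A) :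
    F.left (T₁ Δ t) = T₁ Δ t := by
  induction t with
  | zero => simp only [map_zero]
  | add s t hs ht => simp only [map_add, hs, ht]
  | tmul a b =>
    apply embed_injective (hN.tensor hN)
    rw [← Multiplier.mul_embed, embed_T₁ hN hc, ← mul_assoc, hF]

theorem right_T₂_of_coproduct_mul (hN : IsNondegenerateAlgebra A) (hc : IsCoproduct Δ)
    {F : Multiplier (A ⊗[ℂ] A)} (hF : ∀ a, Δ a * F = Δ a) (t : A ⊗[ℂ] A) :
    F.right (T₂ Δ t) = T₂ Δ t := by
  induction t with
  | zero => simp only [map_zero]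
  | add s t hs ht => simp only [map_add, hs, ht]
  | tmul a b =>
    apply embed_injective (hN.tensor hN)
    rw [← Multiplier.embed_mul, embed_T₂ hN hc, mul_assoc, hF]

namespace IsCanonicalIdempotent

variable {E F : Multiplier (A ⊗[ℂ] A)}

theorem exists_T₁ (hE : IsCanonicalIdempotent Δ E) (t : A ⊗[ℂ] A) : ∃ s, T₁ Δ s = E.left t := by
  rw [← LinearMap.mem_range, ← hE.range_left]
  exact ⟨t, rfl⟩

theorem exists_T₂ (hE : IsCanonicalIdempotent Δ E) (t : A ⊗[ℂ] A) : ∃ s, T₂ Δ s = E.right t := by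
  rw [← LinearMap.mem_range, ← hE.range_right]
  exact ⟨t, rfl⟩

theorem left_T₁ (hE : IsCanonicalIdempotent Δ E) (t : A ⊗[ℂ] A) : E.left (T₁ Δ t) = T₁ Δ t := by
  obtain ⟨s, hs⟩ : T₁ Δ t ∈ LinearMap.range E.left := hE.range_left ▸ ⟨t, rfl⟩
  rw [← hs, ← Multiplier.mul_left_apply, hE.idem]

theorem right_T₂ (hE : IsCanonicalIdempotent Δ E) (t : A ⊗[ℂ] A) :
    E.right (T₂ Δ t) = T₂ Δ t := by
  obtain ⟨s, hs⟩ : T₂ Δ t ∈ LinearMap.range E.right := hE.range_right ▸ ⟨t, rfl⟩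
  rw [← hs, ← Multiplier.mul_right_apply, hE.idem]

theorem mul_coproduct (hE : IsCanonicalIdempotent Δ E) (hN : IsNondegenerateAlgebra A)
    (hc : IsCoproduct Δ) (a : A) : E * Δ a = Δ a := by
  refine Multiplier.left_injective (hN.tensor hN) fun t => ?_
  induction t with
  | zero => simp only [map_zero]
  | add s t hs ht => simp only [map_add, hs, ht]
  | tmul x b =>
    rw [Multiplier.mul_left_apply, coproduct_left_tmul hN hc,
      E.left_rTensor_mulRight (hN.tensor hN), hE.left_T₁]

theorem coproduct_mul (hE : IsCanonicalIdempotent Δ E) (hN : IsNondegenerateAlgebra A)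
    (hc : IsCoproduct Δ) (a : A) : Δ a * E = Δ a := by
  refine Multiplier.right_injective (hN.tensor hN) fun t => ?_
  induction t with
  | zero => simp only [map_zero]
  | add s t hs ht => simp only [map_add, hs, ht]
  | tmul x b =>
    rw [Multiplier.mul_right_apply, coproduct_right_tmul hN hc,
      E.right_lTensor_mulLeft (hN.tensor hN), hE.right_T₂]

theorem mul_eq_of_mul_coproduct (hE : IsCanonicalIdempotent Δ E) (hN : IsNondegenerateAlgebra A)
    (hc : IsCoproduct Δ) (hF : ∀ a, F * Δ a = Δ a) : F * E = E :=
  Multiplier.left_injective (hN.tensor hN) fun t => by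
    obtain ⟨s, hs⟩ := hE.exists_T₁ t
    rw [Multiplier.mul_left_apply, ← hs, left_T₁_of_mul_coproduct hN hc hF]

theorem mul_eq_of_coproduct_mul (hE : IsCanonicalIdempotent Δ E) (hN : IsNondegenerateAlgebra A)
    (hc : IsCoproduct Δ) (hF : ∀ a, Δ a * F = Δ a) : E * F = E :=
  Multiplier.right_injective (hN.tensor hN) fun t => by
    obtain ⟨s, hs⟩ := hE.exists_T₂ t
    rw [Multiplier.mul_right_apply, ← hs, right_T₂_of_coproduct_mul hN hc hF]

theorem unique (hE : IsCanonicalIdempotent Δ E) (hF : IsCanonicalIdempotent Δ F)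
    (hN : IsNondegenerateAlgebra A) (hc : IsCoproduct Δ) : E = F :=
  (hE.mul_eq_of_coproduct_mul hN hc (hF.coproduct_mul hN hc)).symm.trans
    (hF.mul_eq_of_mul_coproduct hN hc (hE.mul_coproduct hN hc))

end IsCanonicalIdempotent

/-- The multiplier of `A ⊗ A` obtained from `m` by exchanging the two legs. -/
def Multiplier.flip (m : Multiplier (A ⊗[ℂ] A)) : Multiplier (A ⊗[ℂ] A) :=
  transport (TensorProduct.comm ℂ A A) comm_mul m

namespace Multiplier

theorem flip_left (m : Multiplier (A ⊗[ℂ] A)) (t : A ⊗[ℂ] A) :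
    m.flip.left t = TensorProduct.comm ℂ A A (m.left (TensorProduct.comm ℂ A A t)) := rfl

theorem flip_right (m : Multiplier (A ⊗[ℂ] A)) (t : A ⊗[ℂ] A) :
    m.flip.right t = TensorProduct.comm ℂ A A (m.right (TensorProduct.comm ℂ A A t)) := rfl

theorem flip_mul (m n : Multiplier (A ⊗[ℂ] A)) : (m * n).flip = m.flip * n.flip :=
  map_mul _ m n

theorem flip_flip (m : Multiplier (A ⊗[ℂ] A)) : m.flip.flip = m :=
  ext (LinearMap.ext fun t => by simp only [flip_left, TensorProduct.comm_comm])
    (LinearMap.ext fun t => by simp only [flip_right, TensorProduct.comm_comm])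

theorem flip_tens (m n : Multiplier A) : (tens m n).flip = tens n m :=
  ext (TensorProduct.ext' fun _ _ => rfl) (TensorProduct.ext' fun _ _ => rfl)

end Multiplier

theorem cop_apply (a : A) : cop Δ a = (Δ a).flip := rfl

theorem IsCanonicalIdempotent.cop {E : Multiplier (A ⊗[ℂ] A)} (hE : IsCanonicalIdempotent Δ E)
    (hA : IsRegularWeakMultiplierHopfAlgebra Δ) : IsCanonicalIdempotent (cop Δ) E.flip := by
  obtain ⟨F, hF, -⟩ := hA.weak_cop.canonical
  have hN := hA.weak.nondegenerate
  have hc := hA.weak.coproduct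
  have hc' := hA.weak_cop.coproduct
  have F_mul_flip : F * E.flip = F := hF.mul_eq_of_coproduct_mul hN hc' fun a => by
    rw [cop_apply, ← Multiplier.flip_mul, hE.coproduct_mul hN hc]
  have flip_mul_E : F.flip * E = E := hE.mul_eq_of_mul_coproduct hN hc fun a => by
    rw [← (Δ a).flip_flip, ← Multiplier.flip_mul, ← cop_apply, hF.mul_coproduct hN hc']
  have flip_eq : E.flip = F := by
    rw [← F_mul_flip, ← F.flip_flip, ← Multiplier.flip_mul, flip_mul_E]
  exact flip_eq ▸ hF

end CanonicalMaps

section LegCalculus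

variable {A : Type*} [NonUnitalRing A] [Module ℂ A]

theorem lTensor_sliceRight_leg13 (ω : A →ₗ[ℂ] ℂ) (t : (A ⊗[ℂ] A) ⊗[ℂ] A) :
    LinearMap.lTensor A (sliceRight ω) (leg13 t) = LinearMap.rTensor A (sliceRight ω) t := by
  have h : LinearMap.lTensor A (sliceRight ω) ∘ₗ leg13.toLinearMap =
      LinearMap.rTensor A (sliceRight ω) :=
    TensorProduct.ext_threefold fun p q b => by
      simp [leg13, sliceRight_tmul, TensorProduct.smul_tmul]
  exact LinearMap.congr_fun h t

theorem lTensor_sliceRight_onLegs12 (ω : A →ₗ[ℂ] ℂ) (G : A ⊗[ℂ] A →ₗ[ℂ] A ⊗[ℂ] A)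
    (t : A ⊗[ℂ] (A ⊗[ℂ] A)) :
    LinearMap.lTensor A (sliceRight ω) (onLegs12 G t) =
      G (LinearMap.lTensor A (sliceRight ω) t) := by
  obtain ⟨t, rfl⟩ := (TensorProduct.assoc ℂ A A A).surjective t
  induction t with
  | zero => simp only [map_zero]
  | add x y hx hy => simp only [map_add, hx, hy]
  | tmul s q => simp [onLegs12, lTensor_sliceRight_assoc_tmul]

variable [IsScalarTower ℂ A A] [SMulCommClass ℂ A A]

theorem transport_leg13_tens (l m n : Multiplier A) :
    transport leg13 leg13_mul (tens (tens l m) n) = tens l (tens n m) :=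
  Multiplier.ext (TensorProduct.ext <| LinearMap.ext fun _ => TensorProduct.ext' fun _ _ => rfl)
    (TensorProduct.ext <| LinearMap.ext fun _ => TensorProduct.ext' fun _ _ => rfl)

theorem transport_assoc_tens (l m n : Multiplier A) :
    transport (TensorProduct.assoc ℂ A A A) assoc_mul (tens (tens l m) n) = tens l (tens m n) :=
  Multiplier.ext (TensorProduct.ext <| LinearMap.ext fun _ => TensorProduct.ext' fun _ _ => rfl)
    (TensorProduct.ext <| LinearMap.ext fun _ => TensorProduct.ext' fun _ _ => rfl)

theorem tensOne_left_assoc_tmul (E : Multiplier (A ⊗[ℂ] A)) (t : A ⊗[ℂ] A) (b : A) :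
    (tensOne E).left (TensorProduct.assoc ℂ A A A (t ⊗ₜ b)) =
      TensorProduct.assoc ℂ A A A (E.left t ⊗ₜ b) := by
  rw [tensOne, transport_left]
  rfl

variable {Δ : A →ₙₐ[ℂ] Multiplier (A ⊗[ℂ] A)}

theorem coprod13_mul (hN : IsNondegenerateAlgebra A) (hc : IsCoproduct Δ) (a : A)
    (t : A ⊗[ℂ] A) :
    coprod13 Δ a * tens 1 (embed (TensorProduct.comm ℂ A A t)) =
      embed (leg13 (LinearMap.rTensor A (T₁ Δ ∘ₗ TensorProduct.mk ℂ A A a) t)) := by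
  induction t with
  | zero => simp only [map_zero, mul_zero]
  | add x y hx hy => simp only [map_add, mul_add, hx, hy]
  | tmul c b =>
    rw [TensorProduct.comm_tmul, ← tens_embed_embed, ← transport_leg13_tens, coprod13, ← map_mul,
      tens_mul_tens, ← embed_T₁ hN hc, one_mul, tens_embed_embed, transport_embed]
    rfl

/-- The map `v ↦ Δ(v)y`. -/
def coproductAt (Δ : A →ₙₐ[ℂ] Multiplier (A ⊗[ℂ] A)) (y : A ⊗[ℂ] A) : A →ₗ[ℂ] A ⊗[ℂ] A where
  toFun v := (Δ v).left y
  map_add' u v := by rw [map_add]; rfl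
  map_smul' c v := by rw [map_smul]; rfl

/-- The map `p ↦ Δ(p)(1 ⊗ b)`. -/
def T₁At (Δ : A →ₙₐ[ℂ] Multiplier (A ⊗[ℂ] A)) (b : A) : A →ₗ[ℂ] A ⊗[ℂ] A :=
  T₁ Δ ∘ₗ (TensorProduct.mk ℂ A A).flip b

theorem embed_lTensor_coproductAt (y t : A ⊗[ℂ] A) :
    embed (LinearMap.lTensor A (coproductAt Δ y) t) = idTensorCoprod Δ t * tens 1 (embed y) := by
  induction t with
  | zero => simp only [map_zero, zero_mul]
  | add s t hs ht => simp only [map_add, add_mul, hs, ht]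
  | tmul p q =>
    change _ = tens (embed p) (Δ q) * _
    rw [tens_mul_tens, mul_one, Multiplier.mul_embed, tens_embed_embed]
    rfl

theorem embed_lTensor_T₁At (hN : IsNondegenerateAlgebra A) (hc : IsCoproduct Δ) (b : A)
    (t : A ⊗[ℂ] A) :
    embed (LinearMap.lTensor A (T₁At Δ b) t) =
      idTensorCoprod Δ t * tens 1 (tens 1 (embed b)) := by
  induction t with
  | zero => simp only [map_zero, zero_mul]
  | add s t hs ht => simp only [map_add, add_mul, hs, ht]
  | tmul p q =>
    change _ = tens (embed p) (Δ q) * _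
    rw [tens_mul_tens, mul_one, ← embed_T₁ hN hc, tens_embed_embed]
    rfl

theorem embed_assoc_rTensor_T₁At (hN : IsNondegenerateAlgebra A) (hc : IsCoproduct Δ) (b : A)
    (t : A ⊗[ℂ] A) :
    embed (TensorProduct.assoc ℂ A A A (LinearMap.rTensor A (T₁At Δ b) t)) =
      coprodTensorId Δ t * tens 1 (tens (embed b) 1) := by
  induction t with
  | zero => simp only [map_zero, zero_mul]
  | add s t hs ht => simp only [map_add, add_mul, hs, ht]
  | tmul p q =>
    change _ = transport _ assoc_mul (tens (Δ p) (embed q)) * _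
    rw [← transport_assoc_tens, ← map_mul, tens_mul_tens, mul_one, ← embed_T₁ hN hc,
      tens_embed_embed, transport_embed]
    rfl

theorem coassoc_T₁At (hN : IsNondegenerateAlgebra A) (hc : IsCoproduct Δ) (a b c d : A) :
    LinearMap.rTensor (A ⊗[ℂ] A) (LinearMap.mulLeft ℂ d)
        (TensorProduct.assoc ℂ A A A (LinearMap.rTensor A (T₁At Δ b) (T₁ Δ (a ⊗ₜ c)))) =
      LinearMap.lTensor A (coproductAt Δ (b ⊗ₜ c)) (T₂ Δ (d ⊗ₜ a)) := by
  apply embed_injective (hN.tensor (hN.tensor hN))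
  change embed ((tens (embed d) (1 : Multiplier (A ⊗[ℂ] A))).left _) = _
  rw [← Multiplier.mul_embed, embed_assoc_rTensor_T₁At hN hc, ← mul_assoc, hc.coassoc, mul_assoc,
    tens_mul_tens, tens_mul_tens, embed_lTensor_coproductAt, mul_one, one_mul, mul_one,
    tens_embed_embed]

theorem tensOne_left_lTensor_T₁At (hN : IsNondegenerateAlgebra A) (hc : IsCoproduct Δ)
    {E : Multiplier (A ⊗[ℂ] A)} (hE : IsCanonicalIdempotent Δ E)
    (hx : IsExtensionValue (idTensorCoprod Δ) (oneTens E) E (tensOne E * oneTens E)) (b : A)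
    (t : A ⊗[ℂ] A) :
    (tensOne E).left (LinearMap.lTensor A (T₁At Δ b) t) =
      LinearMap.lTensor A (T₁At Δ b) (E.left t) := by
  have hfix : (oneTens E).left (LinearMap.lTensor A (T₁At Δ b) t) =
      LinearMap.lTensor A (T₁At Δ b) t := by
    induction t with
    | zero => simp only [map_zero]
    | add x y hx hy => simp only [map_add, hx, hy]
    | tmul p q => exact congrArg (TensorProduct.mk ℂ A _ p) (hE.left_T₁ (q ⊗ₜ b))
  apply embed_injective (hN.tensor (hN.tensor hN))
  rw [embed_lTensor_T₁At hN hc, ← hx.2.2.1, mul_assoc, ← embed_lTensor_T₁At hN hc,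
    Multiplier.mul_embed, Multiplier.mul_left_apply, hfix]

end LegCalculus

section CounitMaps

variable {A : Type*} [NonUnitalRing A] [Module ℂ A] [IsScalarTower ℂ A A] [SMulCommClass ℂ A A]
variable {Δ : A →ₙₐ[ℂ] Multiplier (A ⊗[ℂ] A)} {E : Multiplier (A ⊗[ℂ] A)} {ε : A →ₗ[ℂ] ℂ}

/-- The map `y ↦ (ι ⊗ ε)(Ey)`. -/
def leftUnitMap (E : Multiplier (A ⊗[ℂ] A)) (ε : A →ₗ[ℂ] ℂ) : A ⊗[ℂ] A →ₗ[ℂ] A :=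
  sliceRight ε ∘ₗ E.left

/-- The map `a ⊗ c ↦ (ι ⊗ ε)(Δ(a)(1 ⊗ c))`. -/
def rightUnitMap (Δ : A →ₙₐ[ℂ] Multiplier (A ⊗[ℂ] A)) (ε : A →ₗ[ℂ] ℂ) : A ⊗[ℂ] A →ₗ[ℂ] A :=
  sliceRight ε ∘ₗ T₁ Δ

theorem leftUnitMap_rTensor_mulRight (hN : IsNondegenerateAlgebra A) (d : A) (t : A ⊗[ℂ] A) :
    leftUnitMap E ε (LinearMap.rTensor A (LinearMap.mulRight ℂ d) t) = leftUnitMap E ε t * d := by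
  simp only [leftUnitMap, LinearMap.comp_apply,
    Multiplier.left_rTensor_mulRight (hN.tensor hN), sliceRight_rTensor, LinearMap.mulRight_apply]

theorem rTensor_mulLeft_comm_T₁_cop (hA : IsRegularWeakMultiplierHopfAlgebra Δ) (c a b : A) :
    LinearMap.rTensor A (LinearMap.mulLeft ℂ c)
        (TensorProduct.comm ℂ A A (T₁ (cop Δ) (a ⊗ₜ b))) =
      LinearMap.rTensor A (LinearMap.mulRight ℂ b) (T₂ Δ (c ⊗ₜ a)) := by
  have hN := hA.weak.nondegenerate
  apply embed_injective (hN.tensor hN)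
  have hflip : embed (TensorProduct.comm ℂ A A (T₁ (cop Δ) (a ⊗ₜ b))) =
      Δ a * tens (embed b) 1 := by
    rw [← transport_embed _ comm_mul]
    change (embed (T₁ (cop Δ) (a ⊗ₜ b))).flip = _
    rw [embed_T₁ hN hA.weak_cop.coproduct, Multiplier.flip_mul, cop_apply,
      Multiplier.flip_flip, Multiplier.flip_tens]
  change embed ((tens (embed c) (1 : Multiplier A)).left _) =
    embed ((tens (embed b) (1 : Multiplier A)).right _)
  rw [← Multiplier.mul_embed, hflip, ← Multiplier.embed_mul, embed_T₂ hN hA.weak.coproduct,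
    mul_assoc]

theorem IsCounit.sliceRight_comm_T₁_cop (hε : IsCounit Δ ε)
    (hA : IsRegularWeakMultiplierHopfAlgebra Δ) (a b : A) :
    sliceRight ε (TensorProduct.comm ℂ A A (T₁ (cop Δ) (a ⊗ₜ b))) = a * b := by
  refine hA.weak.nondegenerate.eq_of_mul_left fun c => ?_
  have h := congrArg (sliceRight ε) (rTensor_mulLeft_comm_T₁_cop hA c a b)
  rw [sliceRight_rTensor, sliceRight_rTensor] at h
  exact h.trans ((congrArg (· * b) (hε.2 c a)).trans (mul_assoc c a b))

theorem IsCounit.sliceRight_coproduct_left (hε : IsCounit Δ ε)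
    (hA : IsRegularWeakMultiplierHopfAlgebra Δ) (hE : IsCanonicalIdempotent Δ E) (a : A)
    (t : A ⊗[ℂ] A) : sliceRight ε ((Δ a).left t) = a * leftUnitMap E ε t := by
  obtain ⟨s, hs⟩ := (hE.cop hA).exists_T₁ (TensorProduct.comm ℂ A A t)
  have hEt : E.left t = TensorProduct.comm ℂ A A (T₁ (cop Δ) s) := by
    rw [hs, Multiplier.flip_left, TensorProduct.comm_comm, TensorProduct.comm_comm]
  rw [← hE.coproduct_mul hA.weak.nondegenerate hA.weak.coproduct a, Multiplier.mul_left_apply,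
    leftUnitMap, LinearMap.comp_apply, hEt]
  clear hs hEt
  induction s with
  | zero => simp only [map_zero, mul_zero]
  | add x y hx hy => simp only [map_add, mul_add, hx, hy]
  | tmul q r =>
    have hΔ : (Δ a).left (TensorProduct.comm ℂ A A (T₁ (cop Δ) (q ⊗ₜ r))) =
        TensorProduct.comm ℂ A A (T₁ (cop Δ) ((a * q) ⊗ₜ r)) := by
      rw [T₁_mul_tmul hA.weak.nondegenerate hA.weak_cop.coproduct, cop_apply,
        Multiplier.flip_left, TensorProduct.comm_comm]
    rw [hΔ, hε.sliceRight_comm_T₁_cop hA, hε.sliceRight_comm_T₁_cop hA, mul_assoc]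

theorem IsCounit.rightUnitMap_mul (hε : IsCounit Δ ε) (hA : IsRegularWeakMultiplierHopfAlgebra Δ)
    (hE : IsCanonicalIdempotent Δ E) (a b c : A) :
    rightUnitMap Δ ε (a ⊗ₜ c) * b = a * leftUnitMap E ε (b ⊗ₜ c) := by
  rw [← hε.sliceRight_coproduct_left hA hE,
    coproduct_left_tmul hA.weak.nondegenerate hA.weak.coproduct, sliceRight_rTensor]
  rfl

theorem IsWeakMultiplierHopfAlgebra.isExtensionValue (hA : IsWeakMultiplierHopfAlgebra Δ)
    (hE : IsCanonicalIdempotent Δ E) :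
    IsExtensionValue (idTensorCoprod Δ) (oneTens E) E (tensOne E * oneTens E) := by
  obtain ⟨F, hF, hx, -⟩ := hA.canonical
  rwa [hE.unique hF hA.nondegenerate hA.coproduct]

theorem IsWeakMultiplierHopfAlgebra.tensOne_mul_oneTens (hA : IsWeakMultiplierHopfAlgebra Δ)
    (hE : IsCanonicalIdempotent Δ E) : tensOne E * oneTens E = oneTens E * tensOne E := by
  obtain ⟨F, hF, -, hcomm, -⟩ := hA.canonical
  rwa [hE.unique hF hA.nondegenerate hA.coproduct]

theorem lTensor_sliceLeft_tensOne_left (t : A ⊗[ℂ] (A ⊗[ℂ] A)) :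
    LinearMap.lTensor A (sliceLeft ε) ((tensOne E).left t) =
      LinearMap.rTensor A (leftUnitMap E ε) ((TensorProduct.assoc ℂ A A A).symm t) := by
  obtain ⟨t, rfl⟩ := (TensorProduct.assoc ℂ A A A).surjective t
  rw [LinearEquiv.symm_apply_apply]
  induction t with
  | zero => simp only [map_zero]
  | add x y hx hy => simp only [map_add, hx, hy]
  | tmul s b => rw [tensOne_left_assoc_tmul, lTensor_sliceLeft_assoc_tmul]; rfl

theorem T₁_tmul_mul_mem_range (hA : IsWeakMultiplierHopfAlgebra Δ)
    (hE : IsCanonicalIdempotent Δ E) (hε : IsCounit Δ ε) (a y z : A) :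
    T₁ Δ (a ⊗ₜ (y * z)) ∈ LinearMap.range (LinearMap.rTensor A (leftUnitMap E ε)) := by
  have hN := hA.nondegenerate
  refine ⟨(TensorProduct.assoc ℂ A A A).symm
    (LinearMap.lTensor A (T₁At Δ z) (T₁ Δ (a ⊗ₜ y))), ?_⟩
  have hslice : sliceLeft ε ∘ₗ T₁At Δ z = LinearMap.mulRight ℂ z :=
    LinearMap.ext fun p => hε.1 p z
  rw [← lTensor_sliceLeft_tensOne_left,
    tensOne_left_lTensor_T₁At hN hA.coproduct hE (hA.isExtensionValue hE), hE.left_T₁,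
    ← LinearMap.lTensor_comp_apply, hslice, ← T₁_lTensor_mulRight hN hA.coproduct]
  rfl

theorem leftUnitMap_surjective (hA : IsWeakMultiplierHopfAlgebra Δ)
    (hE : IsCanonicalIdempotent Δ E) (hε : IsCounit Δ ε) :
    Function.Surjective (leftUnitMap E ε) := by
  rw [← LinearMap.range_eq_top]
  apply hA.full.1
  have hle : LinearMap.range (LinearMap.rTensor A (leftUnitMap E ε)) ≤
      LinearMap.range (LinearMap.rTensor A (LinearMap.range (leftUnitMap E ε)).subtype) := by
    rintro _ ⟨t, rfl⟩
    refine ⟨LinearMap.rTensor A (leftUnitMap E ε).rangeRestrict t, ?_⟩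
    rw [← LinearMap.rTensor_comp_apply]
    rfl
  rintro _ ⟨t, rfl⟩
  refine hle ?_
  induction t with
  | zero => rw [map_zero]; exact Submodule.zero_mem _
  | add x y hx hy => rw [map_add]; exact Submodule.add_mem _ hx hy
  | tmul a b =>
    have hspan : ⊤ ≤ (LinearMap.range (LinearMap.rTensor A (leftUnitMap E ε))).comap
        (T₁ Δ ∘ₗ TensorProduct.mk ℂ A A a) := by
      rw [← hA.idempotent, Submodule.span_le]
      rintro _ ⟨y, z, rfl⟩
      exact T₁_tmul_mul_mem_range hA hE hε a y z
    exact hspan (Submodule.mem_top (x := b))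

theorem rightUnitMap_surjective (hA : IsWeakMultiplierHopfAlgebra Δ)
    (hE : IsCanonicalIdempotent Δ E) (hε : IsCounit Δ ε) :
    Function.Surjective (rightUnitMap Δ ε) := fun a => by
  obtain ⟨t, rfl⟩ := leftUnitMap_surjective hA hE hε a
  obtain ⟨s, hs⟩ := hE.exists_T₁ t
  exact ⟨s, congrArg (sliceRight ε) hs⟩

end CounitMaps

section KernelProjections

variable {A : Type*} [NonUnitalRing A] [Module ℂ A] [IsScalarTower ℂ A A] [SMulCommClass ℂ A A]

/-- Right linearity of an operator on `A ⊗ A` over the second leg: `f(t(1 ⊗ c)) = f(t)(1 ⊗ c)`. -/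
def IsRightLinear (f : A ⊗[ℂ] A →ₗ[ℂ] A ⊗[ℂ] A) : Prop :=
  ∀ c t, f (LinearMap.lTensor A (LinearMap.mulRight ℂ c) t) =
    LinearMap.lTensor A (LinearMap.mulRight ℂ c) (f t)

variable {V : Type*} [AddCommGroup V] [Module ℂ V]
variable {Δ : A →ₙₐ[ℂ] Multiplier (A ⊗[ℂ] A)} {E : Multiplier (A ⊗[ℂ] A)} {ε : A →ₗ[ℂ] ℂ}
  {G : A ⊗[ℂ] A →ₗ[ℂ] A ⊗[ℂ] A}

/-- The map `c ⊗ v ↦ (ι ⊗ ε)(Δ(a)(1 ⊗ c)) ⊗ v`, which applies `ι ⊗ ε ⊗ ι` to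
`Δ(a)(1 ⊗ c) ⊗ v`. It turns the defining formula of `G₁` into one that does not involve `Δ₁₃`. -/
def crossMap (Δ : A →ₙₐ[ℂ] Multiplier (A ⊗[ℂ] A)) (ε : A →ₗ[ℂ] ℂ) (a : A) :
    A ⊗[ℂ] V →ₗ[ℂ] A ⊗[ℂ] V :=
  LinearMap.rTensor V (rightUnitMap Δ ε ∘ₗ TensorProduct.mk ℂ A A a)

theorem crossMap_tmul (a c : A) (v : V) :
    crossMap Δ ε a (c ⊗ₜ v) = rightUnitMap Δ ε (a ⊗ₜ c) ⊗ₜ v := rfl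

theorem crossMap_lTensor {W : Type*} [AddCommGroup W] [Module ℂ W] (f : V →ₗ[ℂ] W) (a : A)
    (t : A ⊗[ℂ] V) :
    crossMap Δ ε a (LinearMap.lTensor A f t) = LinearMap.lTensor A f (crossMap Δ ε a t) := by
  simp only [crossMap, ← LinearMap.comp_apply, LinearMap.rTensor_comp_lTensor,
    LinearMap.lTensor_comp_rTensor]

theorem ext_crossMap (hψ : Function.Surjective (rightUnitMap Δ ε)) {W : Type*}
    [AddCommGroup W] [Module ℂ W] {f g : A ⊗[ℂ] V →ₗ[ℂ] W}
    (h : ∀ a t, f (crossMap Δ ε a t) = g (crossMap Δ ε a t)) : f = g := by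
  refine TensorProduct.ext' fun x v => ?_
  obtain ⟨t, rfl⟩ := hψ x
  induction t with
  | zero => simp only [map_zero, TensorProduct.zero_tmul]
  | add s t hs ht => simp only [map_add, TensorProduct.add_tmul, hs, ht]
  | tmul a c => exact h a (c ⊗ₜ v)

theorem T₁_crossMap (hA : IsRegularWeakMultiplierHopfAlgebra Δ)
    (hE : IsCanonicalIdempotent Δ E) (hε : IsCounit Δ ε) (a : A) (t : A ⊗[ℂ] A) :
    T₁ Δ (crossMap Δ ε a t) = T₁ Δ (a ⊗ₜ leftUnitMap E ε (TensorProduct.comm ℂ A A t)) := by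
  have hN := hA.weak.nondegenerate
  have hc := hA.weak.coproduct
  induction t with
  | zero => simp only [map_zero, TensorProduct.tmul_zero]
  | add x y hx hy => simp only [map_add, TensorProduct.tmul_add, hx, hy]
  | tmul c b =>
    refine hN.eq_of_rTensor_mulLeft fun d => ?_
    have hslice (s : A ⊗[ℂ] A) : LinearMap.lTensor A (sliceRight ε)
        (TensorProduct.assoc ℂ A A A (LinearMap.rTensor A (T₁At Δ b) s)) =
        T₁At Δ b (sliceRight ε s) := by
      induction s with
      | zero => simp only [map_zero]
      | add x y hx hy => simp only [map_add, hx, hy]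
      | tmul p q =>
        rw [LinearMap.rTensor_tmul, lTensor_sliceRight_assoc_tmul, sliceRight_tmul, map_smul]
    have hcoproduct : sliceRight ε ∘ₗ coproductAt Δ (b ⊗ₜ c) =
        LinearMap.mulRight ℂ (leftUnitMap E ε (b ⊗ₜ c)) :=
      LinearMap.ext fun v => hε.sliceRight_coproduct_left hA hE v (b ⊗ₜ c)
    have h := congrArg (LinearMap.lTensor A (sliceRight ε)) (coassoc_T₁At hN hc a b c d)
    rw [← LinearMap.comp_apply, LinearMap.lTensor_comp_rTensor, ← LinearMap.rTensor_comp_lTensor,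
      LinearMap.comp_apply, hslice, ← LinearMap.lTensor_comp_apply, hcoproduct,
      ← rTensor_mulLeft_T₁ hN hc] at h
    exact h

theorem IsG₁.map_crossMap (hG : IsG₁ Δ E G) (hN : IsNondegenerateAlgebra A)
    (hc : IsCoproduct Δ) (a : A) (t : A ⊗[ℂ] A) :
    G (crossMap Δ ε a t) = crossMap Δ ε a (E.flip.left t) := by
  have hslice (t : A ⊗[ℂ] A) : LinearMap.lTensor A (sliceRight ε)
      (leg13 (LinearMap.rTensor A (T₁ Δ ∘ₗ TensorProduct.mk ℂ A A a) t)) = crossMap Δ ε a t := by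
    rw [lTensor_sliceRight_leg13, ← LinearMap.rTensor_comp_apply]
    rfl
  induction t with
  | zero => simp only [map_zero]
  | add s t hs ht => simp only [map_add, hs, ht]
  | tmul c b =>
    have h := hG a b c
    rw [tens_embed_embed, mul_assoc, oneTens, tens_mul_tens, one_mul, Multiplier.mul_embed,
      ← TensorProduct.comm_comm ℂ A A (E.left _), coprod13_mul hN hc] at h
    have hleg := congrArg (LinearMap.lTensor A (sliceRight ε))
      (embed_injective (hN.tensor (hN.tensor hN)) h)
    rw [lTensor_sliceRight_onLegs12, hslice] at hleg
    rw [Multiplier.flip_left, TensorProduct.comm_tmul, ← hleg, lTensor_sliceRight_leg13]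
    rfl

/-- `G` acts as the projection `G₁` of the definition of a weak multiplier Hopf algebra: its kernel
is `ker T₁`. The flip of `E` appears because `crossMap` records the legs of `1 ⊗ E` in the opposite
order. -/
structure IsKernelProjection (Δ : A →ₙₐ[ℂ] Multiplier (A ⊗[ℂ] A)) (E : Multiplier (A ⊗[ℂ] A))
    (ε : A →ₗ[ℂ] ℂ) (G : A ⊗[ℂ] A →ₗ[ℂ] A ⊗[ℂ] A) : Prop where
  map_crossMap : ∀ a t, G (crossMap Δ ε a t) = crossMap Δ ε a (E.flip.left t)
  isRightLinear : IsRightLinear G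
  T₁_map : ∀ t, T₁ Δ (G t) = T₁ Δ t
  map_eq_zero : ∀ t, T₁ Δ t = 0 → G t = 0

theorem exists_isKernelProjection (hA : IsWeakMultiplierHopfAlgebra Δ)
    (hE : IsCanonicalIdempotent Δ E) (hε : IsCounit Δ ε) : ∃ G, IsKernelProjection Δ E ε G := by
  have hN := hA.nondegenerate
  obtain ⟨F, hF, -, -, ⟨G, hG, hker⟩, -⟩ := hA.canonical
  obtain rfl := hE.unique hF hN hA.coproduct
  have hψ := rightUnitMap_surjective hA hE hε
  have hcross := hG.map_crossMap (ε := ε) hN hA.coproduct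
  have hidem : G ∘ₗ G = G := ext_crossMap hψ fun a t => by
    rw [LinearMap.comp_apply, hcross, hcross, ← Multiplier.mul_left_apply,
      ← Multiplier.flip_mul, hE.idem]
  refine ⟨G, hcross, fun c t => ?_, fun t => ?_, fun t ht => ?_⟩
  · have hlin : G ∘ₗ LinearMap.lTensor A (LinearMap.mulRight ℂ c) =
        LinearMap.lTensor A (LinearMap.mulRight ℂ c) ∘ₗ G := ext_crossMap hψ fun a t => by
      rw [LinearMap.comp_apply, LinearMap.comp_apply, ← crossMap_lTensor, hcross, hcross,
        Multiplier.left_lTensor_mulRight (hN.tensor hN), crossMap_lTensor]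
    exact LinearMap.congr_fun hlin t
  · have hmem : t - G t ∈ LinearMap.ker (T₁ Δ) := hker ▸ ⟨t, rfl⟩
    rw [LinearMap.mem_ker, map_sub, sub_eq_zero] at hmem
    exact hmem.symm
  · have hmem : t ∈ LinearMap.range (LinearMap.id - G) := hker ▸ ht
    obtain ⟨s, rfl⟩ := hmem
    rw [LinearMap.sub_apply, LinearMap.id_apply, map_sub, ← LinearMap.comp_apply, hidem, sub_self]

theorem IsKernelProjection.map_eq (hG : IsKernelProjection Δ E ε G) {s t : A ⊗[ℂ] A}
    (h : T₁ Δ s = T₁ Δ t) : G s = G t := by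
  rw [← sub_eq_zero, ← map_sub]
  exact hG.map_eq_zero _ (by rw [map_sub, h, sub_self])

end KernelProjections

section LocalUnits

variable {A : Type*} [NonUnitalRing A] [Module ℂ A] [IsScalarTower ℂ A A] [SMulCommClass ℂ A A]
variable {Δ : A →ₙₐ[ℂ] Multiplier (A ⊗[ℂ] A)} {E : Multiplier (A ⊗[ℂ] A)} {ε : A →ₗ[ℂ] ℂ}
  {G : A ⊗[ℂ] A →ₗ[ℂ] A ⊗[ℂ] A}

theorem lTensor_mkQ_T₁ (hN : IsNondegenerateAlgebra A) (hc : IsCoproduct Δ) (a z : A) :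
    LinearMap.lTensor A (LinearMap.range (LinearMap.mulRight ℂ z)).mkQ (T₁ Δ (a ⊗ₜ z)) = 0 := by
  refine eq_zero_of_forall_rTensor (fun d : A => LinearMap.mulLeft ℂ d) hN.2 _ fun d => ?_
  rw [← LinearMap.comp_apply, LinearMap.rTensor_comp_lTensor, ← LinearMap.lTensor_comp_rTensor,
    LinearMap.comp_apply, rTensor_mulLeft_T₁ hN hc, ← LinearMap.lTensor_comp_apply,
    LinearMap.range_mkQ_comp, LinearMap.lTensor_zero, LinearMap.zero_apply]

theorem IsKernelProjection.lTensor_mkQ_map (hG : IsKernelProjection Δ E ε G)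
    (hN : IsNondegenerateAlgebra A) (hc : IsCoproduct Δ) (hE : IsCanonicalIdempotent Δ E)
    (a z : A) :
    LinearMap.lTensor A (LinearMap.range (LinearMap.mulRight ℂ z)).mkQ (G (a ⊗ₜ z)) = 0 := by
  have hexact := lTensor_exact A (LinearMap.exact_map_mkQ_range (LinearMap.mulRight ℂ z))
    (Submodule.mkQ_surjective _)
  obtain ⟨t, ht⟩ := (hexact _).1 (lTensor_mkQ_T₁ hN hc a z)
  obtain ⟨s, hs⟩ := hE.exists_T₁ t
  have hT : T₁ Δ (a ⊗ₜ z) = T₁ Δ (LinearMap.lTensor A (LinearMap.mulRight ℂ z) s) := by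
    rw [T₁_lTensor_mulRight hN hc, hs, ← Multiplier.left_lTensor_mulRight (hN.tensor hN), ht,
      hE.left_T₁]
  rw [hG.map_eq hT, hG.isRightLinear]
  exact hexact.apply_apply_eq_zero _

theorem lTensor_mkQ_crossMap (hA : IsRegularWeakMultiplierHopfAlgebra Δ)
    (hE : IsCanonicalIdempotent Δ E) (hε : IsCounit Δ ε) (a : A) (y : A ⊗[ℂ] A) :
    LinearMap.lTensor A (LinearMap.range (LinearMap.mulRight ℂ (leftUnitMap E ε y))).mkQ
      (crossMap Δ ε a (TensorProduct.comm ℂ A A (E.left y))) = 0 := by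
  obtain ⟨G, hG⟩ := exists_isKernelProjection hA.weak hE hε
  have hT := T₁_crossMap hA hE hε a (TensorProduct.comm ℂ A A y)
  rw [TensorProduct.comm_comm] at hT
  rw [← hG.lTensor_mkQ_map hA.weak.nondegenerate hA.weak.coproduct hE a, ← hG.map_eq hT,
    hG.map_crossMap, Multiplier.flip_left, TensorProduct.comm_comm]

/-- The operators `b ↦ (ι ⊗ ε)(E(b ⊗ c))` on `A`, as a linear function of `c`. -/
def leftUnitOperator (E : Multiplier (A ⊗[ℂ] A)) (ε : A →ₗ[ℂ] ℂ) : A →ₗ[ℂ] Module.End ℂ A :=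
  (TensorProduct.curry (leftUnitMap E ε)).flip

theorem map_leftUnitOperator_mkQ (hA : IsRegularWeakMultiplierHopfAlgebra Δ)
    (hE : IsCanonicalIdempotent Δ E) (hε : IsCounit Δ ε) (y : A ⊗[ℂ] A) :
    TensorProduct.map (leftUnitOperator E ε)
      (LinearMap.range (LinearMap.mulRight ℂ (leftUnitMap E ε y))).mkQ
      (TensorProduct.comm ℂ A A (E.left y)) = 0 := by
  set N := LinearMap.range (LinearMap.mulRight ℂ (leftUnitMap E ε y))
  refine eq_zero_of_forall_rTensor
    (fun p : A × A => LinearMap.mulLeft ℂ p.1 ∘ₗ LinearMap.applyₗ p.2) (fun f hf =>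
      LinearMap.ext fun b => hA.weak.nondegenerate.2 _ fun a => hf (a, b)) _ ?_
  rintro ⟨a, b⟩
  have hcross (t : A ⊗[ℂ] A) : LinearMap.rTensor (A ⧸ N) (LinearMap.mulLeft ℂ a ∘ₗ
        LinearMap.applyₗ b) (TensorProduct.map (leftUnitOperator E ε) N.mkQ t) =
      LinearMap.rTensor (A ⧸ N) (LinearMap.mulRight ℂ b)
        (LinearMap.lTensor A N.mkQ (crossMap Δ ε a t)) := by
    induction t with
    | zero => simp only [map_zero]
    | add s t hs ht => simp only [map_add, hs, ht]
    | tmul c d =>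
      rw [crossMap_tmul, LinearMap.lTensor_tmul, LinearMap.rTensor_tmul,
        LinearMap.mulRight_apply, hε.rightUnitMap_mul hA hE]
      rfl
  exact (hcross _).trans (by rw [lTensor_mkQ_crossMap hA hE hε, map_zero])

theorem exists_mul_eq_self (hA : IsRegularWeakMultiplierHopfAlgebra Δ) (z : A) :
    ∃ e : A, e * z = z := by
  obtain ⟨E, hE, -⟩ := hA.weak.canonical
  obtain ⟨ε, hε⟩ := hA.weak.counit
  obtain ⟨y, rfl⟩ := leftUnitMap_surjective hA.weak hE hε z
  set z := leftUnitMap E ε y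
  set θ := (leftUnitOperator E ε).rangeRestrict
  let eval : LinearMap.range (leftUnitOperator E ε) ⊗[ℂ] A →ₗ[ℂ] A :=
    TensorProduct.lift (LinearMap.range (leftUnitOperator E ε)).subtype
  have heval (t : A ⊗[ℂ] A) : eval (LinearMap.rTensor A θ t) =
      leftUnitMap E ε (TensorProduct.comm ℂ A A t) := by
    induction t with
    | zero => simp only [map_zero]
    | add s t hs ht => simp only [map_add, hs, ht]
    | tmul c b => rfl
  have hzero : LinearMap.lTensor _ (LinearMap.range (LinearMap.mulRight ℂ z)).mkQ
      (LinearMap.rTensor A θ (TensorProduct.comm ℂ A A (E.left y))) = 0 := by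
    apply Module.Flat.rTensor_preserves_injective_linearMap (Submodule.subtype _)
      (Submodule.injective_subtype (LinearMap.range (leftUnitOperator E ε)))
    rw [map_zero]
    refine Eq.trans ?_ (map_leftUnitOperator_mkQ hA hE hε y)
    exact LinearMap.congr_fun (TensorProduct.ext' fun _ _ => rfl :
      LinearMap.rTensor _ (Submodule.subtype _) ∘ₗ LinearMap.lTensor _ (Submodule.mkQ _) ∘ₗ
        LinearMap.rTensor A θ = TensorProduct.map _ (Submodule.mkQ _)) _
  obtain ⟨u, hu⟩ := (lTensor_exact _ (LinearMap.exact_map_mkQ_range (LinearMap.mulRight ℂ z))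
    (Submodule.mkQ_surjective _) _).1 hzero
  have hEy : eval (LinearMap.lTensor _ (LinearMap.mulRight ℂ z) u) = z := by
    rw [hu, heval, TensorProduct.comm_comm]
    exact congrArg (sliceRight ε) (by rw [← Multiplier.mul_left_apply, hE.idem])
  refine ⟨eval u, Eq.trans ?_ hEy⟩
  clear hu hEy
  induction u with
  | zero => simp only [map_zero, zero_mul]
  | add s t hs ht => simp only [map_add, add_mul, hs, ht]
  | tmul f b =>
    obtain ⟨_, c, rfl⟩ := f
    exact (leftUnitMap_rTensor_mulRight hA.weak.nondegenerate z (b ⊗ₜ c)).symm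

theorem exists_leftLocalUnit (hA : IsRegularWeakMultiplierHopfAlgebra Δ) (s : Finset A) :
    ∃ e : A, ∀ a ∈ s, e * a = a := by
  classical
  induction s using Finset.induction_on with
  | empty => exact ⟨0, by simp⟩
  | insert a s _ ih =>
    obtain ⟨e, he⟩ := ih
    obtain ⟨f, hf⟩ := exists_mul_eq_self hA (a - e * a)
    refine ⟨e + f - f * e, fun b hb => ?_⟩
    rw [sub_mul, add_mul, mul_assoc]
    rcases Finset.mem_insert.1 hb with rfl | hb
    · rw [mul_sub] at hf
      rw [add_sub_assoc, hf, add_sub_cancel]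
    · rw [he b hb, add_sub_cancel_right]

end LocalUnits

section SmoothModules

variable {B : Type*} [NonUnitalRing B] [Module ℂ B]
  {V : Type*} [AddCommGroup V] [Module ℂ V] {W : Type*} [AddCommGroup W] [Module ℂ W]
  {U : Type*} [AddCommGroup U] [Module ℂ U] {ρ : B →ₙₐ[ℂ] Module.End ℂ V}

theorem IsUnitalModule.lift_surjective (hρ : IsUnitalModule ρ) :
    Function.Surjective (TensorProduct.lift (ρ : B →ₗ[ℂ] Module.End ℂ V)) := by
  rw [← LinearMap.range_eq_top, eq_top_iff, ← (hρ : Submodule.span ℂ _ = ⊤), Submodule.span_le]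
  rintro _ ⟨b, v, rfl⟩
  exact ⟨b ⊗ₜ v, rfl⟩

/-- A unital module `V` over a non-unital algebra that is also non-degenerate: `v = 0` if `bv = 0`
for all `b`. These are the modules whose action extends to the multiplier algebra. -/
structure IsSmooth (ρ : B →ₙₐ[ℂ] Module.End ℂ V) : Prop where
  unital : IsUnitalModule ρ
  nondegenerate : ∀ v, (∀ b, ρ b v = 0) → v = 0

theorem IsSmooth.eq (h : IsSmooth ρ) {v w : V} (hvw : ∀ b, ρ b v = ρ b w) : v = w := by
  rw [← sub_eq_zero]
  exact h.nondegenerate _ fun b => by rw [map_sub, hvw, sub_self]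

variable [SMulCommClass ℂ B B]

theorem lift_rTensor_mulLeft {h : B →ₗ[ℂ] V →ₗ[ℂ] W}
    (hh : ∀ e b v, h (e * b) v = h e (ρ b v)) (e : B) (t : B ⊗[ℂ] V) :
    TensorProduct.lift h (LinearMap.rTensor V (LinearMap.mulLeft ℂ e) t) =
      h e (TensorProduct.lift (ρ : B →ₗ[ℂ] Module.End ℂ V) t) := by
  induction t with
  | zero => simp only [map_zero]
  | add s t hs ht => simp only [map_add, hs, ht]
  | tmul b v => exact hh e b v

variable [IsScalarTower ℂ B B]
variable {C : Type*} [NonUnitalRing C] [Module ℂ C] [IsScalarTower ℂ C C] [SMulCommClass ℂ C C]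
  {D : Type*} [NonUnitalRing D] [Module ℂ D] [IsScalarTower ℂ D D] [SMulCommClass ℂ D D]
  {σ : C →ₙₐ[ℂ] Module.End ℂ W} {τ : D →ₙₐ[ℂ] Module.End ℂ U}

namespace IsSmooth

theorem ext_apply (h : IsSmooth ρ) (m : Multiplier B) (b : B) (v : V) :
    extendedAction ρ m (ρ b v) = ρ (m.left b) v :=
  extendedAction_apply ρ h.unital h.nondegenerate m b v

theorem ext_eq (h : IsSmooth ρ) {m : Multiplier B} {f : Module.End ℂ V}
    (hf : ∀ b v, f (ρ b v) = ρ (m.left b) v) : extendedAction ρ m = f := by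
  refine LinearMap.ext_on h.unital ?_
  rintro _ ⟨b, v, rfl⟩
  rw [h.ext_apply, hf]

theorem ext_mul (h : IsSmooth ρ) (m n : Multiplier B) (v : V) :
    extendedAction ρ (m * n) v = extendedAction ρ m (extendedAction ρ n v) :=
  LinearMap.congr_fun (h.ext_eq (f := extendedAction ρ m ∘ₗ extendedAction ρ n) fun b v => by
    rw [LinearMap.comp_apply, h.ext_apply, h.ext_apply, Multiplier.mul_left_apply]) v

theorem ext_embed (h : IsSmooth ρ) (b : B) : extendedAction ρ (embed b) = ρ b :=
  h.ext_eq fun c v => by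
    rw [← Module.End.mul_apply, ← map_mul]
    rfl

theorem ext_one (h : IsSmooth ρ) : extendedAction ρ (1 : Multiplier B) = LinearMap.id :=
  h.ext_eq fun _ _ => rfl

theorem ext_zero (h : IsSmooth ρ) : extendedAction ρ (0 : Multiplier B) = 0 :=
  h.ext_eq fun _ v => (LinearMap.congr_fun (map_zero ρ) v).symm

theorem ext_add (h : IsSmooth ρ) (m n : Multiplier B) :
    extendedAction ρ (m + n) = extendedAction ρ m + extendedAction ρ n :=
  h.ext_eq fun b v => by
    rw [LinearMap.add_apply, h.ext_apply, h.ext_apply, ← LinearMap.add_apply, ← map_add]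
    rfl

theorem apply_ext (h : IsSmooth ρ) (m : Multiplier B) (b : B) (v : V) :
    ρ b (extendedAction ρ m v) = ρ (m.right b) v := by
  rw [← h.ext_embed, ← h.ext_mul, Multiplier.embed_mul, h.ext_embed]

theorem ext_map_left (h : IsSmooth ρ) {φ : B →ₗ[ℂ] V} (hφ : ∀ b c, ρ b (φ c) = φ (b * c))
    (m : Multiplier B) (c : B) : extendedAction ρ m (φ c) = φ (m.left c) :=
  h.eq fun b => by rw [h.apply_ext, hφ, m.right_mul_eq, ← hφ]

theorem ext_map (h : IsSmooth ρ) (k : IsSmooth σ) {φ : W →ₗ[ℂ] V} {θ : B → Multiplier C}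
    (hφ : ∀ b w, ρ b (φ w) = φ (extendedAction σ (θ b) w)) {m : Multiplier B} {n : Multiplier C}
    (hθ : ∀ b, θ (m.right b) = θ b * n) (w : W) :
    extendedAction ρ m (φ w) = φ (extendedAction σ n w) :=
  h.eq fun b => by rw [h.apply_ext, hφ, hφ, hθ, k.ext_mul]

theorem ext_transport (h : IsSmooth ρ) (k : IsSmooth σ) (e : C ≃ₗ[ℂ] B)
    (he : ∀ x y, e (x * y) = e x * e y) {φ : W →ₗ[ℂ] V}
    (hφ : ∀ c w, φ (σ c w) = ρ (e c) (φ w)) (m : Multiplier C) (w : W) :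
    extendedAction ρ (transport e he m) (φ w) = φ (extendedAction σ m w) :=
  h.ext_map k (θ := fun b => embed (e.symm b))
    (fun b w => by rw [k.ext_embed, hφ, e.apply_symm_apply])
    (fun b => by
      rw [Multiplier.embed_mul]
      exact congrArg embed (e.symm_apply_apply _)) w

theorem tensor (h : IsSmooth ρ) (k : IsSmooth σ) : IsSmooth (tensorAction ρ σ) where
  unital := by
    have hV : Submodule.span ℂ {x | ∃ b v, x = ρ b v} = ⊤ := h.unital
    have hW : Submodule.span ℂ {x | ∃ c w, x = σ c w} = ⊤ := k.unital
    rw [IsUnitalModule, eq_top_iff, ← TensorProduct.map₂_mk_top_top_eq_top, ← hV, ← hW,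
      Submodule.map₂_span_span]
    refine Submodule.span_mono ?_
    rintro _ ⟨_, ⟨b, v, rfl⟩, _, ⟨c, w, rfl⟩, rfl⟩
    exact ⟨b ⊗ₜ c, v ⊗ₜ w, rfl⟩
  nondegenerate t ht := by
    refine eq_zero_of_forall_rTensor (fun b => ρ b) h.nondegenerate t fun b => ?_
    refine eq_zero_of_forall_lTensor (fun c => σ c) k.nondegenerate _ fun c => ?_
    rw [← LinearMap.comp_apply, LinearMap.lTensor_comp_rTensor]
    exact ht (b ⊗ₜ c)

theorem ext_tens (h : IsSmooth ρ) (k : IsSmooth σ) (m : Multiplier B) (n : Multiplier C) :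
    extendedAction (tensorAction ρ σ) (tens m n) =
      TensorProduct.map (extendedAction ρ m) (extendedAction σ n) := by
  refine (h.tensor k).ext_eq fun t x => ?_
  induction t with
  | zero => simp only [map_zero, LinearMap.zero_apply]
  | add s t hs ht => simp only [map_add, LinearMap.add_apply, hs, ht]
  | tmul b c =>
    induction x with
    | zero => simp only [map_zero]
    | add s t hs ht => simp only [map_add, hs, ht]
    | tmul v w =>
      rw [tensorAction_tmul, TensorProduct.map_tmul, h.ext_apply, k.ext_apply]
      rfl

end IsSmooth

theorem assoc_tensorAction (x : (B ⊗[ℂ] C) ⊗[ℂ] D) (v : (V ⊗[ℂ] W) ⊗[ℂ] U) :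
    TensorProduct.assoc ℂ V W U (tensorAction (tensorAction ρ σ) τ x v) =
      tensorAction ρ (tensorAction σ τ) (TensorProduct.assoc ℂ B C D x)
        (TensorProduct.assoc ℂ V W U v) := by
  have h : (tensorAction (tensorAction ρ σ) τ : _ →ₗ[ℂ] _).compr₂
        (TensorProduct.assoc ℂ V W U).toLinearMap =
      (tensorAction ρ (tensorAction σ τ) : _ →ₗ[ℂ] _).compl₁₂
        (TensorProduct.assoc ℂ B C D).toLinearMap (TensorProduct.assoc ℂ V W U).toLinearMap := by
    ext
    rfl
  exact LinearMap.congr_fun₂ h x v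

theorem IsSmooth.ext_tensOne {A : Type*} [NonUnitalRing A] [Module ℂ A] [IsScalarTower ℂ A A]
    [SMulCommClass ℂ A A] {ρ : A →ₙₐ[ℂ] Module.End ℂ V} {σ : A →ₙₐ[ℂ] Module.End ℂ W}
    {τ : A →ₙₐ[ℂ] Module.End ℂ U} (h : IsSmooth ρ) (k : IsSmooth σ) (l : IsSmooth τ)
    (m : Multiplier (A ⊗[ℂ] A)) (n : Multiplier A) (x : V ⊗[ℂ] W) (u : U) :
    extendedAction (B := A ⊗[ℂ] (A ⊗[ℂ] A)) (tensorAction ρ (tensorAction σ τ))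
        (transport (TensorProduct.assoc ℂ A A A) assoc_mul (tens m n))
        (TensorProduct.assoc ℂ V W U (x ⊗ₜ u)) =
      TensorProduct.assoc ℂ V W U
        (extendedAction (tensorAction ρ σ) m x ⊗ₜ extendedAction τ n u) := by
  have hassoc := (h.tensor (k.tensor l)).ext_transport ((h.tensor k).tensor l)
    (TensorProduct.assoc ℂ A A A) assoc_mul (φ := (TensorProduct.assoc ℂ V W U).toLinearMap)
    (fun b v => assoc_tensorAction b v) (tens m n) (x ⊗ₜ u)
  rw [(h.tensor k).ext_tens l] at hassoc
  exact hassoc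

end SmoothModules

section UnitalModules

variable {A : Type*} [NonUnitalRing A] [Module ℂ A] [IsScalarTower ℂ A A] [SMulCommClass ℂ A A]
  {V : Type*} [AddCommGroup V] [Module ℂ V] {W : Type*} [AddCommGroup W] [Module ℂ W]
  {Δ : A →ₙₐ[ℂ] Multiplier (A ⊗[ℂ] A)} {ρ : A →ₙₐ[ℂ] Module.End ℂ V}

theorem exists_rTensor_mulLeft_eq_self (hA : IsRegularWeakMultiplierHopfAlgebra Δ)
    (t : A ⊗[ℂ] V) : ∃ e : A, LinearMap.rTensor V (LinearMap.mulLeft ℂ e) t = t := by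
  classical
  obtain ⟨S, rfl⟩ := TensorProduct.exists_finset t
  obtain ⟨e, he⟩ := exists_leftLocalUnit hA (S.image Prod.fst)
  refine ⟨e, ?_⟩
  rw [map_sum]
  refine Finset.sum_congr rfl fun p hp => ?_
  rw [LinearMap.rTensor_tmul, LinearMap.mulLeft_apply, he _ (Finset.mem_image_of_mem _ hp)]

theorem IsUnitalModule.exists_linearMap (hA : IsRegularWeakMultiplierHopfAlgebra Δ)
    (hρ : IsUnitalModule ρ) {h : A →ₗ[ℂ] V →ₗ[ℂ] W}
    (hh : ∀ e b v, h (e * b) v = h e (ρ b v)) : ∃ f : V →ₗ[ℂ] W, ∀ b v, f (ρ b v) = h b v := by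
  obtain ⟨s, hs⟩ := LinearMap.exists_rightInverse_of_surjective
    (TensorProduct.lift (ρ : A →ₗ[ℂ] Module.End ℂ V))
    (LinearMap.range_eq_top.2 hρ.lift_surjective)
  refine ⟨TensorProduct.lift h ∘ₗ s, fun b v => ?_⟩
  set t := s (ρ b v) - b ⊗ₜ v
  have ht : TensorProduct.lift (ρ : A →ₗ[ℂ] Module.End ℂ V) t = 0 := by
    rw [map_sub, sub_eq_zero]
    exact LinearMap.congr_fun hs _
  obtain ⟨e, he⟩ := exists_rTensor_mulLeft_eq_self hA t
  have hzero : TensorProduct.lift h t = 0 := by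
    rw [← he, lift_rTensor_mulLeft hh, ht, map_zero]
  rw [map_sub, sub_eq_zero] at hzero
  exact hzero

theorem IsUnitalModule.exists_apply_eq_self (hA : IsRegularWeakMultiplierHopfAlgebra Δ)
    (hρ : IsUnitalModule ρ) (v : V) : ∃ e, ρ e v = v := by
  obtain ⟨t, rfl⟩ := hρ.lift_surjective v
  obtain ⟨e, he⟩ := exists_rTensor_mulLeft_eq_self hA t
  have hmul (e b : A) (v : V) : (ρ : A →ₗ[ℂ] Module.End ℂ V) (e * b) v =
      (ρ : A →ₗ[ℂ] Module.End ℂ V) e (ρ b v) := LinearMap.congr_fun (map_mul ρ e b) v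
  exact ⟨e, (lift_rTensor_mulLeft hmul e t).symm.trans (congrArg _ he)⟩

theorem IsUnitalModule.isSmooth (hA : IsRegularWeakMultiplierHopfAlgebra Δ)
    (hρ : IsUnitalModule ρ) : IsSmooth ρ where
  unital := hρ
  nondegenerate v hv := by
    obtain ⟨e, he⟩ := hρ.exists_apply_eq_self hA v
    rw [← he, hv]

theorem isSmooth_leftRegular (hA : IsRegularWeakMultiplierHopfAlgebra Δ) :
    IsSmooth (leftRegular : A →ₙₐ[ℂ] Module.End ℂ A) where
  unital := hA.weak.idempotent
  nondegenerate := hA.weak.nondegenerate.2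

end UnitalModules

section SmashProductCalculus

variable {A : Type*} [NonUnitalRing A] [Module ℂ A] {R : Type*} [NonUnitalRing R] [Module ℂ R]

section LegMultiplication

variable [IsScalarTower ℂ R R] [SMulCommClass ℂ R R]

/-- The product of the first two legs of `R ⊗ R ⊗ A`. -/
def mulLegs : R ⊗[ℂ] (R ⊗[ℂ] A) →ₗ[ℂ] R ⊗[ℂ] A :=
  LinearMap.rTensor A (LinearMap.mul' ℂ R) ∘ₗ (TensorProduct.assoc ℂ R R A).symm.toLinearMap

theorem mulLegs_assoc_tmul (x : R ⊗[ℂ] R) (a : A) :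
    mulLegs (TensorProduct.assoc ℂ R R A (x ⊗ₜ a)) = LinearMap.mul' ℂ R x ⊗ₜ a := by
  rw [mulLegs, LinearMap.comp_apply, LinearEquiv.coe_coe, LinearEquiv.symm_apply_apply,
    LinearMap.rTensor_tmul]

theorem mulLegs_tmul (r : R) (y : R ⊗[ℂ] A) :
    mulLegs (r ⊗ₜ y) = LinearMap.rTensor A (LinearMap.mulLeft ℂ r) y := by
  induction y with
  | zero => simp only [TensorProduct.tmul_zero, map_zero]
  | add s t hs ht => simp only [map_add, TensorProduct.tmul_add, hs, ht]
  | tmul s a => rfl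

end LegMultiplication

variable {act : A →ₙₐ[ℂ] Module.End ℂ R}

/-- The map `p ⊗ q ↦ (p ▷ s) ⊗ q` from `A ⊗ A` to `R ⊗ A`. -/
def actOn (act : A →ₙₐ[ℂ] Module.End ℂ R) (s : R) : A ⊗[ℂ] A →ₗ[ℂ] R ⊗[ℂ] A :=
  LinearMap.rTensor A ((act : A →ₗ[ℂ] Module.End ℂ R).flip s)

theorem actOn_tmul (s : R) (p q : A) : actOn act s (p ⊗ₜ q) = act p s ⊗ₜ q := rfl

variable [IsScalarTower ℂ A A]

theorem actOn_act (w : A ⊗[ℂ] A) (u : A) (s : R) :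
    actOn act (act u s) w = actOn act s (LinearMap.rTensor A (LinearMap.mulRight ℂ u) w) := by
  induction w with
  | zero => simp only [map_zero]
  | add s t hs ht => simp only [map_add, hs, ht]
  | tmul p q => exact congrArg (· ⊗ₜ q) (LinearMap.congr_fun (map_mul act p u) s).symm

variable [SMulCommClass ℂ A A]

theorem smashAction_actOn (s : R) (v w : A ⊗[ℂ] A) :
    smashAction act v (actOn act s w) = actOn act s (v * w) := by
  induction v with
  | zero => simp only [map_zero, LinearMap.zero_apply, zero_mul]
  | add v v' hv hv' => simp only [map_add, LinearMap.add_apply, add_mul, hv, hv']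
  | tmul p q =>
    induction w with
    | zero => simp only [map_zero, mul_zero]
    | add w w' hw hw' => simp only [map_add, mul_add, hw, hw']
    | tmul p' q' =>
      rw [Algebra.TensorProduct.tmul_mul_tmul, actOn_tmul, actOn_tmul, map_mul]
      rfl

/-- The action of `A ⊗ A ⊗ A` on `R ⊗ R ⊗ A`. -/
abbrev tripleAction (act : A →ₙₐ[ℂ] Module.End ℂ R) :
    A ⊗[ℂ] (A ⊗[ℂ] A) →ₙₐ[ℂ] Module.End ℂ (R ⊗[ℂ] (R ⊗[ℂ] A)) :=
  tensorAction act (smashAction act)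

variable {Δ : A →ₙₐ[ℂ] Multiplier (A ⊗[ℂ] A)}

section

variable (hA : IsRegularWeakMultiplierHopfAlgebra Δ)
include hA

theorem isSmooth_smashAction (hs : IsSmooth act) : IsSmooth (smashAction act) :=
  hs.tensor (isSmooth_leftRegular hA)

theorem isSmooth_tripleAction (hs : IsSmooth act) :
    IsSmooth (B := A ⊗[ℂ] (A ⊗[ℂ] A)) (tripleAction act) :=
  hs.tensor (isSmooth_smashAction hA hs)

theorem smashExt_actOn (hs : IsSmooth act) (m : Multiplier (A ⊗[ℂ] A)) (s : R)
    (w : A ⊗[ℂ] A) : smashExt act m (actOn act s w) = actOn act s (m.left w) :=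
  (isSmooth_smashAction hA hs).ext_map_left (φ := actOn act s) (smashAction_actOn s) m w

theorem smashExt_coproduct_tmul (hs : IsSmooth act) (a : A) (s : R) (b : A) :
    smashExt act (Δ a) (s ⊗ₜ b) = actOn act s (T₁ Δ (a ⊗ₜ b)) := by
  obtain ⟨e, he⟩ := hs.unital.exists_apply_eq_self hA s
  calc smashExt act (Δ a) (s ⊗ₜ b)
      = smashExt act (Δ a) (actOn act s (e ⊗ₜ b)) := by rw [actOn_tmul, he]
    _ = actOn act s (T₁ Δ (a ⊗ₜ b)) := by
      rw [smashExt_actOn hA hs, coproduct_left_tmul hA.weak.nondegenerate hA.weak.coproduct,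
        ← actOn_act, he]

end

variable [IsScalarTower ℂ R R] [SMulCommClass ℂ R R] {E : Multiplier (A ⊗[ℂ] A)}

theorem act_mul' (hact : IsModuleAlgebra Δ act) (a : A) (x : R ⊗[ℂ] R) :
    act a (LinearMap.mul' ℂ R x) =
      LinearMap.mul' ℂ R (extendedAction (tensorAction act act) (Δ a) x) := by
  induction x with
  | zero => simp only [map_zero]
  | add s t hs ht => simp only [map_add, hs, ht]
  | tmul x y => exact hact.act_mul a x y

variable (hA : IsRegularWeakMultiplierHopfAlgebra Δ)
include hA

theorem smashMul_tmul_left (hs : IsSmooth act) (r : R) (a : A) (y : R ⊗[ℂ] A) :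
    smashMul Δ act (r ⊗ₜ a) y = mulLegs (r ⊗ₜ smashExt act (Δ a) y) := by
  rw [mulLegs_tmul]
  induction y with
  | zero => simp only [map_zero]
  | add s t hs ht => simp only [map_add, hs, ht]
  | tmul s b =>
    rw [smashExt_coproduct_tmul hA hs, actOn, ← LinearMap.rTensor_comp_apply]
    rfl

theorem smashMul_actOn (hs : IsSmooth act) (r : R) (w : A ⊗[ℂ] A) (y : R ⊗[ℂ] A) :
    smashMul Δ act (actOn act r w) y =
      mulLegs (extendedAction (tripleAction act) (idTensorCoprod Δ w) (r ⊗ₜ y)) := by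
  have hX := isSmooth_smashAction hA hs
  have hZ := isSmooth_tripleAction hA hs
  induction w with
  | zero => simp only [map_zero, LinearMap.zero_apply, hZ.ext_zero]
  | add s t hs ht => simp only [map_add, LinearMap.add_apply, hs, ht, hZ.ext_add]
  | tmul p q =>
    change _ = mulLegs (extendedAction (tripleAction act) (tens (embed p) (Δ q)) (r ⊗ₜ y))
    rw [actOn_tmul, smashMul_tmul_left hA hs, hs.ext_tens hX, hs.ext_embed,
      TensorProduct.map_tmul]
    rfl

theorem mulLegs_ext_assoc_tmul (hs : IsSmooth act) (m : Multiplier (A ⊗[ℂ] A))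
    (n : Multiplier A) (x : R ⊗[ℂ] R) (a : A) :
    mulLegs (extendedAction (B := A ⊗[ℂ] (A ⊗[ℂ] A)) (tripleAction act)
        (transport (TensorProduct.assoc ℂ A A A) assoc_mul (tens m n))
        (TensorProduct.assoc ℂ R R A (x ⊗ₜ a))) =
      LinearMap.mul' ℂ R (extendedAction (tensorAction act act) m x) ⊗ₜ
        extendedAction leftRegular n a :=
  (congrArg mulLegs (hs.ext_tensOne hs (isSmooth_leftRegular hA) m n x a)).trans
    (mulLegs_assoc_tmul _ _)

theorem mul'_ext_idempotent (hact : IsModuleAlgebra Δ act) (hE : IsCanonicalIdempotent Δ E)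
    (x : R ⊗[ℂ] R) :
    LinearMap.mul' ℂ R (extendedAction (tensorAction act act) E x) = LinearMap.mul' ℂ R x := by
  have hs := hact.unital.isSmooth hA
  refine hs.eq fun a => ?_
  rw [act_mul' hact, act_mul' hact, ← (hs.tensor hs).ext_mul,
    hE.coproduct_mul hA.weak.nondegenerate hA.weak.coproduct]

theorem mulLegs_ext_tensOne (hact : IsModuleAlgebra Δ act) (hE : IsCanonicalIdempotent Δ E)
    (ξ : R ⊗[ℂ] (R ⊗[ℂ] A)) :
    mulLegs (extendedAction (tripleAction act) (tensOne E) ξ) = mulLegs ξ := by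
  have hs := hact.unital.isSmooth hA
  have hl := isSmooth_leftRegular hA
  obtain ⟨ξ, rfl⟩ := (TensorProduct.assoc ℂ R R A).surjective ξ
  induction ξ with
  | zero => simp only [map_zero]
  | add s t hs ht => simp only [map_add, hs, ht]
  | tmul x a =>
    rw [mulLegs_assoc_tmul, ← mul'_ext_idempotent hA hact hE]
    refine (mulLegs_ext_assoc_tmul hA hs E 1 x a).trans ?_
    rw [hl.ext_one, LinearMap.id_apply]

theorem smashAction_mulLegs (hact : IsModuleAlgebra Δ act) (t : A ⊗[ℂ] A)
    (ξ : R ⊗[ℂ] (R ⊗[ℂ] A)) :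
    smashAction act t (mulLegs ξ) =
      mulLegs (extendedAction (tripleAction act) (coprodTensorId Δ t) ξ) := by
  have hs := hact.unital.isSmooth hA
  have hl := isSmooth_leftRegular hA
  have hZ := isSmooth_tripleAction hA hs
  induction t with
  | zero => simp only [map_zero, LinearMap.zero_apply, hZ.ext_zero]
  | add s t hs ht => simp only [map_add, LinearMap.add_apply, hs, ht, hZ.ext_add]
  | tmul a b =>
    obtain ⟨ξ, rfl⟩ := (TensorProduct.assoc ℂ R R A).surjective ξ
    induction ξ with
    | zero => simp only [map_zero]
    | add s t hs ht => simp only [map_add, hs, ht]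
    | tmul x c =>
      refine Eq.trans ?_ (mulLegs_ext_assoc_tmul hA hs (Δ a) (embed b) x c).symm
      rw [mulLegs_assoc_tmul, ← act_mul' hact, hl.ext_embed]
      rfl

end SmashProductCalculus

section InducedMaps

variable {A : Type*} [NonUnitalRing A] [Module ℂ A]
  {V : Type*} [AddCommGroup V] [Module ℂ V] {act : A →ₙₐ[ℂ] Module.End ℂ V}

/-- The map `p ⊗ q ↦ p ⊗ (q ▷ v)` from `A ⊗ A` to `A ⊗ V`. -/
def actRight (act : A →ₙₐ[ℂ] Module.End ℂ V) (v : V) : A ⊗[ℂ] A →ₗ[ℂ] A ⊗[ℂ] V :=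
  LinearMap.lTensor A ((act : A →ₗ[ℂ] Module.End ℂ V).flip v)

theorem actRight_tmul (v : V) (p q : A) : actRight act v (p ⊗ₜ q) = p ⊗ₜ act q v := rfl

/-- `F` is the operator on `A ⊗ V ≅ (A ⊗ A) ⊗_A V` obtained from the operator `f` on `A ⊗ A`. -/
def IsInducedMap (act : A →ₙₐ[ℂ] Module.End ℂ V) (f : A ⊗[ℂ] A →ₗ[ℂ] A ⊗[ℂ] A)
    (F : A ⊗[ℂ] V →ₗ[ℂ] A ⊗[ℂ] V) : Prop :=
  ∀ v w, F (actRight act v w) = actRight act v (f w)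

theorem IsInducedMap.comp {f g : A ⊗[ℂ] A →ₗ[ℂ] A ⊗[ℂ] A} {F G : A ⊗[ℂ] V →ₗ[ℂ] A ⊗[ℂ] V}
    (hF : IsInducedMap act f F) (hG : IsInducedMap act g G) :
    IsInducedMap act (f ∘ₗ g) (F ∘ₗ G) := fun v w => by
  rw [LinearMap.comp_apply, hG, hF, LinearMap.comp_apply]

variable [IsScalarTower ℂ A A]

theorem actRight_act (u : A) (v : V) (w : A ⊗[ℂ] A) :
    actRight act (act u v) w = actRight act v (LinearMap.lTensor A (LinearMap.mulRight ℂ u) w) := by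
  induction w with
  | zero => simp only [map_zero]
  | add s t hs ht => simp only [map_add, hs, ht]
  | tmul p q => exact congrArg (p ⊗ₜ ·) (LinearMap.congr_fun (map_mul act q u) v).symm

variable [SMulCommClass ℂ A A]

theorem tensorAction_actRight (v : V) (b c : A ⊗[ℂ] A) :
    tensorAction leftRegular act b (actRight act v c) = actRight act v (b * c) := by
  induction b with
  | zero => simp only [map_zero, LinearMap.zero_apply, zero_mul]
  | add s t hs ht => simp only [map_add, LinearMap.add_apply, add_mul, hs, ht]
  | tmul p q =>
    induction c with
    | zero => simp only [map_zero, mul_zero]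
    | add s t hs ht => simp only [map_add, mul_add, hs, ht]
    | tmul p' q' =>
      rw [Algebra.TensorProduct.tmul_mul_tmul, actRight_tmul, actRight_tmul, map_mul]
      rfl

variable {Δ : A →ₙₐ[ℂ] Multiplier (A ⊗[ℂ] A)} (hA : IsRegularWeakMultiplierHopfAlgebra Δ)
include hA

theorem isInducedMap_extendedAction (hs : IsSmooth act) (m : Multiplier (A ⊗[ℂ] A)) :
    IsInducedMap act m.left (extendedAction (tensorAction leftRegular act) m) := fun v w =>
  ((isSmooth_leftRegular hA).tensor hs).ext_map_left (φ := actRight act v)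
    (tensorAction_actRight v) m w

theorem IsRightLinear.exists_isInducedMap {f : A ⊗[ℂ] A →ₗ[ℂ] A ⊗[ℂ] A} (hf : IsRightLinear f)
    (hact : IsUnitalModule act) : ∃ F, IsInducedMap act f F := by
  obtain ⟨φ, hφ⟩ := hact.exists_linearMap hA
    (h := ((LinearMap.llcomp ℂ A (A ⊗[ℂ] A) (A ⊗[ℂ] V)).compl₁₂
      (LinearMap.lcomp ℂ (A ⊗[ℂ] V) f ∘ₗ LinearMap.lTensorHom A ∘ₗ
        (act : A →ₗ[ℂ] Module.End ℂ V).flip)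
      (TensorProduct.mk ℂ A A).flip).flip)
    fun e b v => LinearMap.ext fun c =>
      (congrArg (actRight act v) (hf b (c ⊗ₜ e))).trans (actRight_act b v _).symm
  refine ⟨TensorProduct.lift φ.flip, fun v w => ?_⟩
  induction w with
  | zero => simp only [map_zero]
  | add s t hs ht => simp only [map_add, hs, ht]
  | tmul c b => exact LinearMap.congr_fun (hφ b v) c

theorem ext_actRight (hact : IsUnitalModule act) {W : Type*} [AddCommGroup W] [Module ℂ W]
    {f g : A ⊗[ℂ] V →ₗ[ℂ] W} (h : ∀ v w, f (actRight act v w) = g (actRight act v w)) : f = g :=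
  TensorProduct.ext' fun a v => by
    obtain ⟨e, he⟩ := hact.exists_apply_eq_self hA v
    rw [← he, ← actRight_tmul, h]

theorem IsInducedMap.unique (hact : IsUnitalModule act) {f : A ⊗[ℂ] A →ₗ[ℂ] A ⊗[ℂ] A}
    {F G : A ⊗[ℂ] V →ₗ[ℂ] A ⊗[ℂ] V} (hF : IsInducedMap act f F) (hG : IsInducedMap act f G) :
    F = G :=
  ext_actRight hA hact fun v w => (hF v w).trans (hG v w).symm

end InducedMaps

section SmashProduct

variable {A : Type*} [NonUnitalRing A] [Module ℂ A] [IsScalarTower ℂ A A] [SMulCommClass ℂ A A]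
  {R : Type*} [NonUnitalRing R] [Module ℂ R]
  {Δ : A →ₙₐ[ℂ] Multiplier (A ⊗[ℂ] A)} {act : A →ₙₐ[ℂ] Module.End ℂ R}
  {E : Multiplier (A ⊗[ℂ] A)}

theorem idTensorCoprod_rTensor_mulLeft (d : A) (w : A ⊗[ℂ] A) :
    idTensorCoprod Δ (LinearMap.rTensor A (LinearMap.mulLeft ℂ d) w) =
      tens (embed d) 1 * idTensorCoprod Δ w := by
  induction w with
  | zero => simp only [map_zero, mul_zero]
  | add s t hs ht => simp only [map_add, mul_add, hs, ht]
  | tmul p q =>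
    change tens (embed (d * p)) (Δ q) = tens (embed d) 1 * tens (embed p) (Δ q)
    rw [tens_mul_tens, one_mul, Multiplier.mul_embed, embed_left]

theorem idTensorCoprod_rTensor_mulRight (d : A) (w : A ⊗[ℂ] A) :
    idTensorCoprod Δ (LinearMap.rTensor A (LinearMap.mulRight ℂ d) w) =
      idTensorCoprod Δ w * tens (embed d) 1 := by
  induction w with
  | zero => simp only [map_zero, zero_mul]
  | add s t hs ht => simp only [map_add, add_mul, hs, ht]
  | tmul p q =>
    change tens (embed (p * d)) (Δ q) = tens (embed p) (Δ q) * tens (embed d) 1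
    rw [tens_mul_tens, mul_one, Multiplier.mul_embed, embed_left]

theorem tens_embed_comm (e v : A) :
    tens (embed e) (1 : Multiplier (A ⊗[ℂ] A)) *
        tens (1 : Multiplier A) (tens (1 : Multiplier A) (embed v)) =
      tens (1 : Multiplier A) (tens (1 : Multiplier A) (embed v)) *
        tens (embed e) (1 : Multiplier (A ⊗[ℂ] A)) := by
  rw [tens_mul_tens, tens_mul_tens, one_mul, mul_one, one_mul, mul_one]

theorem eq_of_tens_embed_mul (hN : IsNondegenerateAlgebra A)
    {m n : Multiplier (A ⊗[ℂ] (A ⊗[ℂ] A))}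
    (h : ∀ d, tens (embed d) 1 * m = tens (embed d) 1 * n) : m = n :=
  Multiplier.left_injective (hN.tensor (hN.tensor hN)) fun x =>
    hN.eq_of_rTensor_mulLeft fun d =>
      congrArg (fun m : Multiplier (A ⊗[ℂ] (A ⊗[ℂ] A)) => m.left x) (h d)

theorem oneTens_mul_idTensorCoprod (hE : IsCanonicalIdempotent Δ E)
    (hN : IsNondegenerateAlgebra A) (hc : IsCoproduct Δ) (w : A ⊗[ℂ] A) :
    oneTens E * idTensorCoprod Δ w = idTensorCoprod Δ w := by
  induction w with
  | zero => simp only [map_zero, mul_zero]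
  | add s t hs ht => simp only [map_add, mul_add, hs, ht]
  | tmul p q =>
    change oneTens E * tens (embed p) (Δ q) = tens (embed p) (Δ q)
    rw [oneTens, tens_mul_tens, one_mul, hE.mul_coproduct hN hc]

section

variable (hA : IsRegularWeakMultiplierHopfAlgebra Δ)
include hA

theorem lTensor_mulRight_comm_T₁_cop (a b e : A) :
    LinearMap.lTensor A (LinearMap.mulRight ℂ b)
        (TensorProduct.comm ℂ A A (T₁ (cop Δ) (a ⊗ₜ e))) = (Δ a).left (e ⊗ₜ b) := by
  rw [← comm_rTensor, ← coproduct_left_tmul hA.weak.nondegenerate hA.weak_cop.coproduct,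
    cop_apply, Multiplier.flip_left, TensorProduct.comm_comm, TensorProduct.comm_tmul]

theorem idTensorCoprod_comm_T₁_cop_mul (b e v : A) :
    idTensorCoprod Δ (TensorProduct.comm ℂ A A (T₁ (cop Δ) (b ⊗ₜ e))) *
        tens (1 : Multiplier A) (tens (1 : Multiplier A) (embed v)) =
      coprodTensorId Δ (T₁ Δ (b ⊗ₜ v)) * tens (embed e) (1 : Multiplier (A ⊗[ℂ] A)) := by
  refine eq_of_tens_embed_mul hA.weak.nondegenerate fun d => ?_
  rw [← mul_assoc, ← idTensorCoprod_rTensor_mulLeft, rTensor_mulLeft_comm_T₁_cop hA,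
    idTensorCoprod_rTensor_mulRight, mul_assoc, tens_embed_comm, ← mul_assoc, ← mul_assoc,
    hA.weak.coproduct.coassoc]

theorem smashExt_tens_one_embed (hs : IsSmooth act) (v : A) (r : R) (c : A) :
    smashExt act (tens 1 (embed v)) (r ⊗ₜ c) = r ⊗ₜ (v * c) := by
  have hl := isSmooth_leftRegular hA
  rw [smashExt, smashAction, hs.ext_tens hl, hs.ext_one, hl.ext_embed]
  rfl

theorem ext_actOn (hact : IsUnitalModule act) {W : Type*} [AddCommGroup W] [Module ℂ W]
    {f g : R ⊗[ℂ] A →ₗ[ℂ] W} (h : ∀ r w, f (actOn act r w) = g (actOn act r w)) : f = g :=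
  TensorProduct.ext' fun r a => by
    obtain ⟨e, he⟩ := hact.exists_apply_eq_self hA r
    rw [← he, ← actOn_tmul, h]

theorem lTensor_mulRight_comm_induced_T₁ (hs : IsSmooth act) {T : A ⊗[ℂ] R →ₗ[ℂ] A ⊗[ℂ] R}
    (hT : IsInducedMap act (T₁ (cop Δ)) T) (a b : A) (t : R) :
    LinearMap.lTensor R (LinearMap.mulRight ℂ b) (TensorProduct.comm ℂ A R (T (a ⊗ₜ t))) =
      smashExt act (Δ a) (t ⊗ₜ b) := by
  obtain ⟨e, he⟩ := hs.unital.exists_apply_eq_self hA t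
  have hcomm (w : A ⊗[ℂ] A) : LinearMap.lTensor R (LinearMap.mulRight ℂ b)
      (TensorProduct.comm ℂ A R (actRight act t w)) = actOn act t
        (LinearMap.lTensor A (LinearMap.mulRight ℂ b) (TensorProduct.comm ℂ A A w)) := by
    rw [actRight, comm_lTensor, actOn, ← LinearMap.comp_apply, ← LinearMap.comp_apply,
      LinearMap.lTensor_comp_rTensor, LinearMap.rTensor_comp_lTensor]
  calc LinearMap.lTensor R (LinearMap.mulRight ℂ b) (TensorProduct.comm ℂ A R (T (a ⊗ₜ t)))
      = LinearMap.lTensor R (LinearMap.mulRight ℂ b)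
          (TensorProduct.comm ℂ A R (T (actRight act t (a ⊗ₜ e)))) := by rw [actRight_tmul, he]
    _ = smashExt act (Δ a) (actOn act t (e ⊗ₜ b)) := by
      rw [hT, hcomm, lTensor_mulRight_comm_T₁_cop hA, smashExt_actOn hA hs]
    _ = smashExt act (Δ a) (t ⊗ₜ b) := by rw [actOn_tmul, he]

end

variable [IsScalarTower ℂ R R] [SMulCommClass ℂ R R]
variable (hA : IsRegularWeakMultiplierHopfAlgebra Δ)
include hA

theorem smashExt_coproduct_mulLegs (hact : IsModuleAlgebra Δ act) (a v c : A) (r s : R) :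
    smashExt act (Δ a) (mulLegs (r ⊗ₜ (s ⊗ₜ (v * c)))) =
      mulLegs (extendedAction (tripleAction act) (coprodTensorId Δ (T₁ Δ (a ⊗ₜ v)))
        (r ⊗ₜ (s ⊗ₜ c))) := by
  have hs := hact.unital.isSmooth hA
  have hX := isSmooth_smashAction hA hs
  have hmul : mulLegs (r ⊗ₜ[ℂ] (s ⊗ₜ[ℂ] (v * c))) =
      smashExt act (tens 1 (embed v)) (mulLegs (r ⊗ₜ (s ⊗ₜ c))) :=
    (smashExt_tens_one_embed hA hs v (r * s) c).symm
  rw [hmul, smashExt, smashExt, ← hX.ext_mul,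
    ← embed_T₁ hA.weak.nondegenerate hA.weak.coproduct, hX.ext_embed,
    smashAction_mulLegs hA hact]

theorem smashMul_comm_induced_T₁ (hact : IsModuleAlgebra Δ act) {T : A ⊗[ℂ] R →ₗ[ℂ] A ⊗[ℂ] R}
    (hT : IsInducedMap act (T₁ (cop Δ)) T) (b : A) (t : R) (y : R ⊗[ℂ] A) :
    smashMul Δ act (TensorProduct.comm ℂ A R (T (b ⊗ₜ t))) y =
      smashExt act (Δ b) (mulLegs (t ⊗ₜ y)) := by
  have hs := hact.unital.isSmooth hA
  have hX := isSmooth_smashAction hA hs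
  have hZ := isSmooth_tripleAction hA hs
  induction y with
  | zero => simp only [TensorProduct.tmul_zero, map_zero]
  | add s t hs ht => simp only [TensorProduct.tmul_add, map_add, hs, ht]
  | tmul s a =>
    obtain ⟨e, he⟩ := hact.unital.exists_apply_eq_self hA t
    obtain ⟨v, hv⟩ := exists_mul_eq_self hA a
    have hleft : TensorProduct.comm ℂ A R (T (b ⊗ₜ t)) =
        actOn act t (TensorProduct.comm ℂ A A (T₁ (cop Δ) (b ⊗ₜ e))) := by
      rw [actOn, ← comm_lTensor, ← actRight, ← hT, actRight_tmul, he]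
    have hright : t ⊗ₜ[ℂ] (s ⊗ₜ[ℂ] a) = extendedAction (tripleAction act)
        (tens 1 (tens 1 (embed v))) (t ⊗ₜ (s ⊗ₜ a)) := by
      rw [hs.ext_tens hX, hs.ext_one, TensorProduct.map_tmul, ← smashExt,
        smashExt_tens_one_embed hA hs, hv, LinearMap.id_apply]
    have hunit : extendedAction (tripleAction act) (tens (embed e) 1) (t ⊗ₜ (s ⊗ₜ a)) =
        t ⊗ₜ (s ⊗ₜ a) := by
      rw [hs.ext_tens hX, hs.ext_embed, hX.ext_one, TensorProduct.map_tmul, he, LinearMap.id_apply]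
    calc smashMul Δ act (TensorProduct.comm ℂ A R (T (b ⊗ₜ t))) (s ⊗ₜ a)
        = mulLegs (extendedAction (tripleAction act)
            (coprodTensorId Δ (T₁ Δ (b ⊗ₜ v)) * tens (embed e) 1) (t ⊗ₜ (s ⊗ₜ a))) := by
          rw [hleft, smashMul_actOn hA hs, hright, ← hZ.ext_mul,
            idTensorCoprod_comm_T₁_cop_mul hA, ← hright]
      _ = smashExt act (Δ b) (mulLegs (t ⊗ₜ (s ⊗ₜ a))) := by
          rw [hZ.ext_mul, hunit, ← smashExt_coproduct_mulLegs hA hact, hv]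

theorem smashMul_smashExt_coproduct (hs : IsSmooth act) (w : R ⊗[ℂ] A) (b : A)
    (z : R ⊗[ℂ] A) :
    smashMul Δ act w (smashExt act (Δ b) z) =
      smashMul Δ act (LinearMap.lTensor R (LinearMap.mulRight ℂ b) w) z := by
  induction w with
  | zero => simp only [map_zero, LinearMap.zero_apply]
  | add s t hs ht => simp only [map_add, LinearMap.add_apply, hs, ht]
  | tmul r a =>
    rw [LinearMap.lTensor_tmul, LinearMap.mulRight_apply, smashMul_tmul_left hA hs,
      smashMul_tmul_left hA hs, map_mul, smashExt, smashExt, smashExt,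
      (isSmooth_smashAction hA hs).ext_mul]

theorem smashExt_coproduct_smashMul (hact : IsModuleAlgebra Δ act) (a : A) (y z : R ⊗[ℂ] A) :
    smashExt act (Δ a) (smashMul Δ act y z) = smashMul Δ act (smashExt act (Δ a) y) z := by
  have hs := hact.unital.isSmooth hA
  have hT₁ : IsRightLinear (T₁ (cop Δ)) :=
    T₁_lTensor_mulRight hA.weak.nondegenerate hA.weak_cop.coproduct
  obtain ⟨T, hT⟩ := hT₁.exists_isInducedMap hA hact.unital
  induction y with
  | zero => simp only [map_zero, LinearMap.zero_apply]
  | add s t hs ht => simp only [map_add, LinearMap.add_apply, hs, ht]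
  | tmul s b =>
    rw [smashMul_tmul_left hA hs, ← smashMul_comm_induced_T₁ hA hact hT,
      smashMul_smashExt_coproduct hA hs, lTensor_mulRight_comm_induced_T₁ hA hs hT]

theorem smashMul_rTensor_mulLeft (hs : IsSmooth act) (r : R) (x y : R ⊗[ℂ] A) :
    smashMul Δ act (LinearMap.rTensor A (LinearMap.mulLeft ℂ r) x) y =
      LinearMap.rTensor A (LinearMap.mulLeft ℂ r) (smashMul Δ act x y) := by
  induction x with
  | zero => simp only [map_zero, LinearMap.zero_apply]
  | add s t hs ht => simp only [map_add, LinearMap.add_apply, hs, ht]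
  | tmul s a =>
    rw [LinearMap.rTensor_tmul, smashMul_tmul_left hA hs, smashMul_tmul_left hA hs, mulLegs_tmul,
      mulLegs_tmul, LinearMap.mulLeft_apply, LinearMap.mulLeft_mul, LinearMap.rTensor_comp_apply]

theorem smashMul_assoc (hact : IsModuleAlgebra Δ act) (x y z : R ⊗[ℂ] A) :
    smashMul Δ act (smashMul Δ act x y) z = smashMul Δ act x (smashMul Δ act y z) := by
  have hs := hact.unital.isSmooth hA
  induction x with
  | zero => simp only [map_zero, LinearMap.zero_apply]
  | add s t hs ht => simp only [map_add, LinearMap.add_apply, hs, ht]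
  | tmul r a =>
    rw [smashMul_tmul_left hA hs, smashMul_tmul_left hA hs, mulLegs_tmul, mulLegs_tmul,
      smashMul_rTensor_mulLeft hA hs, smashExt_coproduct_smashMul hA hact]

theorem smashMul_smashExt_left (hact : IsModuleAlgebra Δ act) (hE : IsCanonicalIdempotent Δ E)
    (x y : R ⊗[ℂ] A) : smashMul Δ act (smashExt act E x) y = smashMul Δ act x y := by
  have hs := hact.unital.isSmooth hA
  have hcomp : (smashMul Δ act).flip y ∘ₗ smashExt act E = (smashMul Δ act).flip y :=
    ext_actOn hA hact.unital fun r w => by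
      have hw : idTensorCoprod Δ (E.left w) = tensOne E * idTensorCoprod Δ w := by
        rw [← (hA.weak.isExtensionValue hE).2.2.1, mul_assoc,
          oneTens_mul_idTensorCoprod hE hA.weak.nondegenerate hA.weak.coproduct]
      rw [LinearMap.comp_apply, LinearMap.flip_apply, LinearMap.flip_apply, smashExt_actOn hA hs,
        smashMul_actOn hA hs, smashMul_actOn hA hs, hw, (isSmooth_tripleAction hA hs).ext_mul,
        mulLegs_ext_tensOne hA hact hE]
  exact LinearMap.congr_fun hcomp x

theorem smashMul_smashExt_right (hs : IsSmooth act) (hE : IsCanonicalIdempotent Δ E)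
    (x y : R ⊗[ℂ] A) : smashMul Δ act x (smashExt act E y) = smashMul Δ act x y := by
  induction x with
  | zero => simp only [map_zero, LinearMap.zero_apply]
  | add s t hs ht => simp only [map_add, LinearMap.add_apply, hs, ht]
  | tmul r a =>
    rw [smashMul_tmul_left hA hs, smashMul_tmul_left hA hs, smashExt, smashExt,
      ← (isSmooth_smashAction hA hs).ext_mul,
      hE.coproduct_mul hA.weak.nondegenerate hA.weak.coproduct]

theorem smashExt_smashMul_actOn_T₁ (hact : IsModuleAlgebra Δ act)
    (hE : IsCanonicalIdempotent Δ E) (r : R) (u : A ⊗[ℂ] A) (y : R ⊗[ℂ] A) :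
    smashExt act E (smashMul Δ act (actOn act r (T₁ Δ u)) y) =
      smashMul Δ act (actOn act r (T₁ Δ u)) y := by
  have hs := hact.unital.isSmooth hA
  induction u with
  | zero => simp only [map_zero, LinearMap.zero_apply]
  | add s t hs ht => simp only [map_add, LinearMap.add_apply, hs, ht]
  | tmul a b =>
    rw [← smashExt_coproduct_tmul hA hs, ← smashExt_coproduct_smashMul hA hact, smashExt, smashExt,
      ← (isSmooth_smashAction hA hs).ext_mul,
      hE.mul_coproduct hA.weak.nondegenerate hA.weak.coproduct]

theorem smashExt_smashMul (hact : IsModuleAlgebra Δ act) (hE : IsCanonicalIdempotent Δ E)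
    (x y : R ⊗[ℂ] A) : smashExt act E (smashMul Δ act x y) = smashMul Δ act x y := by
  have hcomp : smashExt act E ∘ₗ (smashMul Δ act).flip y ∘ₗ smashExt act E =
      (smashMul Δ act).flip y ∘ₗ smashExt act E :=
    ext_actOn hA hact.unital fun r w => by
      obtain ⟨u, hu⟩ := hE.exists_T₁ w
      simp only [LinearMap.comp_apply, LinearMap.flip_apply]
      rw [smashExt_actOn hA (hact.unital.isSmooth hA), ← hu,
        smashExt_smashMul_actOn_T₁ hA hact hE]
  have hx := LinearMap.congr_fun hcomp x
  simp only [LinearMap.comp_apply, LinearMap.flip_apply, smashMul_smashExt_left hA hact hE] at hx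
  exact hx

end SmashProduct

section Nondegeneracy

variable {A : Type*} [NonUnitalRing A] [Module ℂ A] [IsScalarTower ℂ A A] [SMulCommClass ℂ A A]
  {Δ : A →ₙₐ[ℂ] Multiplier (A ⊗[ℂ] A)} {E : Multiplier (A ⊗[ℂ] A)}
  {ε : A →ₗ[ℂ] ℂ} {G : A ⊗[ℂ] A →ₗ[ℂ] A ⊗[ℂ] A}

theorem IsKernelProjection.exists_inverse (hG : IsKernelProjection Δ E ε G)
    (hN : IsNondegenerateAlgebra A) (hc : IsCoproduct Δ) (hE : IsCanonicalIdempotent Δ E) :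
    ∃ S, IsRightLinear S ∧ S ∘ₗ T₁ Δ = G ∧ T₁ Δ ∘ₗ S = E.left := by
  obtain ⟨s, hs⟩ := Module.projective_lifting_property (T₁ Δ).rangeRestrict
    (E.left.codRestrict (LinearMap.range (T₁ Δ)) fun t => hE.exists_T₁ t)
    (LinearMap.surjective_rangeRestrict _)
  have hsection (t : A ⊗[ℂ] A) : T₁ Δ (s t) = E.left t :=
    congrArg Subtype.val (LinearMap.congr_fun hs t)
  refine ⟨G ∘ₗ s, fun c t => ?_, LinearMap.ext fun t => ?_, LinearMap.ext fun t => ?_⟩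
  · rw [LinearMap.comp_apply, LinearMap.comp_apply, ← hG.isRightLinear]
    refine hG.map_eq ?_
    rw [hsection, T₁_lTensor_mulRight hN hc, hsection,
      Multiplier.left_lTensor_mulRight (hN.tensor hN)]
  · refine hG.map_eq ?_
    rw [hsection, hE.left_T₁]
  · rw [LinearMap.comp_apply, LinearMap.comp_apply, hG.T₁_map, hsection]

variable {R : Type*} [NonUnitalRing R] [Module ℂ R] {act : A →ₙₐ[ℂ] Module.End ℂ R}

theorem isInducedMap_smashExt (hA : IsRegularWeakMultiplierHopfAlgebra Δ) (hs : IsSmooth act)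
    (m : Multiplier (A ⊗[ℂ] A)) :
    IsInducedMap act m.flip.left ((TensorProduct.comm ℂ R A).toLinearMap ∘ₗ smashExt act m ∘ₗ
      (TensorProduct.comm ℂ A R).toLinearMap) := fun v w => by
  simp only [LinearMap.comp_apply, LinearEquiv.coe_coe]
  rw [actRight, comm_lTensor, ← actOn, smashExt_actOn hA hs, actOn, comm_rTensor,
    Multiplier.flip_left]

theorem comm_induced_crossMap (hA : IsRegularWeakMultiplierHopfAlgebra Δ) (hs : IsSmooth act)
    (hG : IsKernelProjection (cop Δ) E.flip ε G) {F : A ⊗[ℂ] R →ₗ[ℂ] A ⊗[ℂ] R}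
    (hF : IsInducedMap act G F) (a : A) (y : A ⊗[ℂ] R) :
    F (crossMap (cop Δ) ε a y) =
      crossMap (cop Δ) ε a (extendedAction (tensorAction leftRegular act) E y) := by
  have hcomp : F ∘ₗ crossMap (cop Δ) ε a =
      crossMap (cop Δ) ε a ∘ₗ extendedAction (tensorAction leftRegular act) E :=
    ext_actRight hA hs.unital fun v w => by
      rw [LinearMap.comp_apply, LinearMap.comp_apply, isInducedMap_extendedAction hA hs, actRight,
        crossMap_lTensor, crossMap_lTensor, ← actRight, hF, hG.map_crossMap, Multiplier.flip_flip]
  exact LinearMap.congr_fun hcomp y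

theorem IsKernelProjection.exists_induced_inverse (hA : IsRegularWeakMultiplierHopfAlgebra Δ)
    (hE : IsCanonicalIdempotent Δ E) (hact : IsUnitalModule act)
    (hG : IsKernelProjection (cop Δ) E.flip ε G) :
    ∃ T S : A ⊗[ℂ] R →ₗ[ℂ] A ⊗[ℂ] R, IsInducedMap act (T₁ (cop Δ)) T ∧
      IsInducedMap act G (S ∘ₗ T) ∧ T ∘ₗ S ∘ₗ T = T ∧
      T ∘ₗ S = (TensorProduct.comm ℂ R A).toLinearMap ∘ₗ smashExt act E ∘ₗ
        (TensorProduct.comm ℂ A R).toLinearMap := by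
  have hN := hA.weak.nondegenerate
  have hT₁ : IsRightLinear (T₁ (cop Δ)) := T₁_lTensor_mulRight hN hA.weak_cop.coproduct
  have hTG : T₁ (cop Δ) ∘ₗ G = T₁ (cop Δ) := LinearMap.ext hG.T₁_map
  obtain ⟨s, hs, hsT, hTs⟩ := hG.exists_inverse hN hA.weak_cop.coproduct (hE.cop hA)
  obtain ⟨T, hT⟩ := hT₁.exists_isInducedMap hA hact
  obtain ⟨S, hS⟩ := hs.exists_isInducedMap hA hact
  have hST : IsInducedMap act G (S ∘ₗ T) := hsT ▸ hS.comp hT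
  have hTST : IsInducedMap act (T₁ (cop Δ)) (T ∘ₗ S ∘ₗ T) := hTG ▸ hT.comp hST
  exact ⟨T, S, hT, hST, hTST.unique hA hact hT,
    (hTs ▸ hT.comp hS).unique hA hact (isInducedMap_smashExt hA (hact.isSmooth hA) E)⟩

theorem smashExt_of_mem (hA : IsRegularWeakMultiplierHopfAlgebra Δ) (hs : IsSmooth act)
    (hE : IsCanonicalIdempotent Δ E) {x : R ⊗[ℂ] A} (hx : x ∈ smashProduct act E) :
    smashExt act E x = x := by
  obtain ⟨y, rfl⟩ := hx
  rw [smashExt, ← (isSmooth_smashAction hA hs).ext_mul, hE.idem]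

variable [IsScalarTower ℂ R R] [SMulCommClass ℂ R R]

theorem eq_zero_of_smashMul_right (hA : IsRegularWeakMultiplierHopfAlgebra Δ)
    (hR : IsNondegenerateAlgebra R) (hs : IsSmooth act) (hE : IsCanonicalIdempotent Δ E)
    {x : R ⊗[ℂ] A} (hx : x ∈ smashProduct act E) (h : ∀ y, smashMul Δ act y x = 0) : x = 0 := by
  have hX := isSmooth_smashAction hA hs
  have hcoproduct (a : A) : smashExt act (Δ a) x = 0 := by
    refine eq_zero_of_forall_rTensor (fun r : R => LinearMap.mulLeft ℂ r) hR.2 _ fun r => ?_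
    rw [← mulLegs_tmul, ← smashMul_tmul_left hA hs]
    exact h _
  rw [← smashExt_of_mem hA hs hE hx]
  refine hX.nondegenerate _ fun t => ?_
  obtain ⟨s, hs⟩ := hE.exists_T₂ t
  rw [smashExt, hX.apply_ext, ← hs]
  clear hs
  induction s with
  | zero => simp only [map_zero, LinearMap.zero_apply]
  | add s t hs ht => simp only [map_add, LinearMap.add_apply, hs, ht, add_zero]
  | tmul a b =>
    rw [← hX.ext_embed, embed_T₂ hA.weak.nondegenerate hA.weak.coproduct, hX.ext_mul, ← smashExt,
      ← smashExt, hcoproduct, map_zero]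

variable (hA : IsRegularWeakMultiplierHopfAlgebra Δ)
include hA

theorem tensorAction_leftRegular_mul' (hact : IsModuleAlgebra Δ act) (w : A ⊗[ℂ] A)
    (η : A ⊗[ℂ] (R ⊗[ℂ] R)) :
    tensorAction leftRegular act w (LinearMap.lTensor A (LinearMap.mul' ℂ R) η) =
      LinearMap.lTensor A (LinearMap.mul' ℂ R) (extendedAction
        (tensorAction leftRegular (tensorAction act act)) (idTensorCoprod Δ w) η) := by
  have hs := hact.unital.isSmooth hA
  have hl := isSmooth_leftRegular hA
  have hZ := hl.tensor (hs.tensor hs)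
  induction w with
  | zero => simp only [map_zero, hZ.ext_zero, LinearMap.zero_apply]
  | add s t hs ht => simp only [map_add, hZ.ext_add, LinearMap.add_apply, hs, ht]
  | tmul p q =>
    change _ = LinearMap.lTensor A (LinearMap.mul' ℂ R) (extendedAction
      (tensorAction leftRegular (tensorAction act act)) (tens (embed p) (Δ q)) η)
    rw [hl.ext_tens (hs.tensor hs), hl.ext_embed]
    induction η with
    | zero => simp only [map_zero]
    | add s t hs ht => simp only [map_add, hs, ht]
    | tmul c ξ =>
      rw [TensorProduct.map_tmul, LinearMap.lTensor_tmul, LinearMap.lTensor_tmul, ← act_mul' hact]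
      rfl

theorem lTensor_mul'_ext_oneTens (hact : IsModuleAlgebra Δ act) (hE : IsCanonicalIdempotent Δ E)
    (η : A ⊗[ℂ] (R ⊗[ℂ] R)) :
    LinearMap.lTensor A (LinearMap.mul' ℂ R) (extendedAction
        (tensorAction leftRegular (tensorAction act act)) (oneTens E) η) =
      LinearMap.lTensor A (LinearMap.mul' ℂ R) η := by
  have hs := hact.unital.isSmooth hA
  have hl := isSmooth_leftRegular hA
  rw [oneTens, hl.ext_tens (hs.tensor hs), hl.ext_one]
  induction η with
  | zero => simp only [map_zero]
  | add s t hs ht => simp only [map_add, hs, ht]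
  | tmul c ξ =>
    rw [TensorProduct.map_tmul, LinearMap.lTensor_tmul, LinearMap.lTensor_tmul,
      mul'_ext_idempotent hA hact hE, LinearMap.id_apply]

theorem ext_idempotent_lTensor_mul' (hact : IsModuleAlgebra Δ act)
    (hE : IsCanonicalIdempotent Δ E) (η : A ⊗[ℂ] (R ⊗[ℂ] R)) :
    extendedAction (tensorAction leftRegular act) E (LinearMap.lTensor A (LinearMap.mul' ℂ R) η) =
      LinearMap.lTensor A (LinearMap.mul' ℂ R) (extendedAction
        (tensorAction leftRegular (tensorAction act act)) (tensOne E) η) := by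
  have hs := hact.unital.isSmooth hA
  have hl := isSmooth_leftRegular hA
  have hZ := hl.tensor (hs.tensor hs)
  rw [(hl.tensor hs).ext_map hZ (tensorAction_leftRegular_mul' hA hact)
    (fun w => ((hA.weak.isExtensionValue hE).2.2.2 w).symm),
    hA.weak.tensOne_mul_oneTens hE, hZ.ext_mul, lTensor_mul'_ext_oneTens hA hact hE]

theorem ext_idempotent_lTensor_mulRight (hact : IsModuleAlgebra Δ act)
    (hE : IsCanonicalIdempotent Δ E) (s : R) (y : A ⊗[ℂ] R) :
    extendedAction (tensorAction leftRegular act) E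
        (LinearMap.lTensor A (LinearMap.mulRight ℂ s) y) =
      LinearMap.lTensor A (LinearMap.mulRight ℂ s)
        (extendedAction (tensorAction leftRegular act) E y) := by
  have hs := hact.unital.isSmooth hA
  have hl := isSmooth_leftRegular hA
  have hmul (y : A ⊗[ℂ] R) : LinearMap.lTensor A (LinearMap.mulRight ℂ s) y =
      LinearMap.lTensor A (LinearMap.mul' ℂ R) (TensorProduct.assoc ℂ A R R (y ⊗ₜ s)) := by
    induction y with
    | zero => simp only [map_zero, TensorProduct.zero_tmul]
    | add s t hs ht => simp only [map_add, TensorProduct.add_tmul, hs, ht]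
    | tmul c r => rfl
  rw [hmul, hmul, ext_idempotent_lTensor_mul' hA hact hE, tensOne, hl.ext_tensOne hs hs, hs.ext_one,
    LinearMap.id_apply]

theorem induced_projection_lTensor_mulRight (hact : IsModuleAlgebra Δ act)
    (hE : IsCanonicalIdempotent Δ E) (hε : IsCounit (cop Δ) ε)
    (hG : IsKernelProjection (cop Δ) E.flip ε G) {F : A ⊗[ℂ] R →ₗ[ℂ] A ⊗[ℂ] R}
    (hF : IsInducedMap act G F) (s : R) (y : A ⊗[ℂ] R) :
    F (LinearMap.lTensor A (LinearMap.mulRight ℂ s) y) =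
      LinearMap.lTensor A (LinearMap.mulRight ℂ s) (F y) := by
  have hcross := comm_induced_crossMap hA (hact.unital.isSmooth hA) hG hF
  have hcomp : F ∘ₗ LinearMap.lTensor A (LinearMap.mulRight ℂ s) =
      LinearMap.lTensor A (LinearMap.mulRight ℂ s) ∘ₗ F :=
    ext_crossMap (rightUnitMap_surjective hA.weak_cop (hE.cop hA) hε) fun a t => by
      rw [LinearMap.comp_apply, LinearMap.comp_apply, ← crossMap_lTensor, hcross, hcross,
        ext_idempotent_lTensor_mulRight hA hact hE, crossMap_lTensor]
  exact LinearMap.congr_fun hcomp y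

theorem smashMul_comm_induced_T₁_tmul (hact : IsModuleAlgebra Δ act)
    {T : A ⊗[ℂ] R →ₗ[ℂ] A ⊗[ℂ] R} (hT : IsInducedMap act (T₁ (cop Δ)) T) (w : A ⊗[ℂ] R) (s : R)
    (c : A) :
    smashMul Δ act (TensorProduct.comm ℂ A R (T w)) (s ⊗ₜ c) =
      LinearMap.lTensor R (LinearMap.mulRight ℂ c) (TensorProduct.comm ℂ A R
        (T (LinearMap.lTensor A (LinearMap.mulRight ℂ s) w))) := by
  induction w with
  | zero => simp only [map_zero, LinearMap.zero_apply]
  | add s t hs ht => simp only [map_add, LinearMap.add_apply, hs, ht]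
  | tmul b t =>
    rw [smashMul_comm_induced_T₁ hA hact hT, LinearMap.lTensor_tmul,
      lTensor_mulRight_comm_induced_T₁ hA (hact.unital.isSmooth hA) hT]
    rfl

theorem eq_zero_of_smashMul_left (hR : IsNondegenerateAlgebra R) (hact : IsModuleAlgebra Δ act)
    (hE : IsCanonicalIdempotent Δ E) {x : R ⊗[ℂ] A} (hx : x ∈ smashProduct act E)
    (h : ∀ y, smashMul Δ act x y = 0) : x = 0 := by
  obtain ⟨ε, hε⟩ := hA.weak_cop.counit
  obtain ⟨G, hG⟩ := exists_isKernelProjection hA.weak_cop (hE.cop hA) hε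
  obtain ⟨T, S, hT, hST, hTST, hTS⟩ := hG.exists_induced_inverse hA hE hact.unital
  set z := S (TensorProduct.comm ℂ R A x) with hz
  have hTz : TensorProduct.comm ℂ A R (T z) = x := by
    rw [hz, ← LinearMap.comp_apply T S, hTS]
    simp only [LinearMap.comp_apply, LinearEquiv.coe_coe, TensorProduct.comm_comm]
    exact smashExt_of_mem hA (hact.unital.isSmooth hA) hE hx
  have hTzs (s : R) : T (LinearMap.lTensor A (LinearMap.mulRight ℂ s) z) = 0 := by
    refine (TensorProduct.comm ℂ A R).map_eq_zero_iff.1 ?_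
    refine eq_zero_of_forall_lTensor (fun c : A => LinearMap.mulRight ℂ c)
      hA.weak.nondegenerate.1 _ fun c => ?_
    rw [← smashMul_comm_induced_T₁_tmul hA hact hT, hTz, h]
  have hSTz : S (T z) = 0 := by
    refine eq_zero_of_forall_lTensor (fun s : R => LinearMap.mulRight ℂ s) hR.1 _ fun s => ?_
    rw [← LinearMap.comp_apply S T, ← induced_projection_lTensor_mulRight hA hact hE hε hG hST,
      LinearMap.comp_apply, hTzs, map_zero]
  rw [← hTz, ← hTST, LinearMap.comp_apply, LinearMap.comp_apply, hSTz, map_zero, map_zero]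

end Nondegeneracy

end WMHA

end

open WMHA in
theorem proposition4p3
    {A : Type*} [NonUnitalRing A] [Module ℂ A] [IsScalarTower ℂ A A] [SMulCommClass ℂ A A]
    {R : Type*} [NonUnitalRing R] [Module ℂ R] [IsScalarTower ℂ R R] [SMulCommClass ℂ R R]
    (Δ : A →ₙₐ[ℂ] Multiplier (A ⊗[ℂ] A)) (hA : IsRegularWeakMultiplierHopfAlgebra Δ)
    (E : Multiplier (A ⊗[ℂ] A)) (hE : IsCanonicalIdempotent Δ E)
    (hR : IsNondegenerateAlgebra R)
    (act : A →ₙₐ[ℂ] Module.End ℂ R) (hact : IsModuleAlgebra Δ act) :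
    -- the product of `R # A` is associative
    (∀ x y z : R ⊗[ℂ] A,
      smashMul Δ act (smashMul Δ act x y) z = smashMul Δ act x (smashMul Δ act y z)) ∧
    -- `R # A` is an `M(A ⊗ A)`-module, extending the action of `A ⊗ A`
    (∀ (m : Multiplier (A ⊗[ℂ] A)) (t : A ⊗[ℂ] A) (x : R ⊗[ℂ] A),
      smashExt act m (smashAction act t x) = smashAction act (m.left t) x) ∧
    (∀ x y : R ⊗[ℂ] A,
      smashMul Δ act (smashExt act E x) y = smashMul Δ act x y ∧
      smashMul Δ act x (smashExt act E y) = smashMul Δ act x y ∧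
      smashExt act E (smashMul Δ act x y) = smashMul Δ act (smashExt act E x) y) ∧
    -- `E ▷ (R # A)` is a subalgebra and a right ideal
    (∀ x ∈ smashProduct act E, ∀ y ∈ smashProduct act E,
      smashMul Δ act x y ∈ smashProduct act E) ∧
    (∀ x ∈ smashProduct act E, ∀ y : R ⊗[ℂ] A, smashMul Δ act x y ∈ smashProduct act E) ∧
    -- its product is non-degenerate
    (∀ x ∈ smashProduct act E,
      (∀ y ∈ smashProduct act E, smashMul Δ act x y = 0) → x = 0) ∧
    (∀ x ∈ smashProduct act E,
      (∀ y ∈ smashProduct act E, smashMul Δ act y x = 0) → x = 0) := by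
  have hs : IsSmooth act := hact.unital.isSmooth hA
  have hideal (x y : R ⊗[ℂ] A) : smashMul Δ act x y ∈ smashProduct act E :=
    ⟨_, smashExt_smashMul hA hact hE x y⟩
  refine ⟨smashMul_assoc hA hact, (isSmooth_smashAction hA hs).ext_apply,
    fun x y => ⟨smashMul_smashExt_left hA hact hE x y, smashMul_smashExt_right hA hs hE x y, ?_⟩,
    fun x _ y _ => hideal x y, fun x _ y => hideal x y, fun x hx h => ?_, fun x hx h => ?_⟩
  · rw [smashExt_smashMul hA hact hE, smashMul_smashExt_left hA hact hE]
  · refine eq_zero_of_smashMul_left hA hR hact hE hx fun y => ?_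
    rw [← smashMul_smashExt_right hA hs hE]
    exact h _ ⟨y, rfl⟩
  · refine eq_zero_of_smashMul_right hA hR hs hE hx fun y => ?_
    rw [← smashMul_smashExt_left hA hact hE]
    exact h _ ⟨y, rfl⟩
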